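/- **Setting.** Let $K\ge 2$, $T\ge 2K$, let $G=([K],E)$ be a directed graph (self-loops allowed), $N^{\rm in}(i)=\{j:(j,i)\in E\}$. $G$ is *strongly observable* if every $i$ has $N^{\rm in}(i)\neq\emptyset$ and satisfies $i\in N^{\rm in}(i)$ or $N^{\rm in}(i)=[K]\setminus\{i\}$. Let $S=\{i: i\in N^{\rm in}(i)\}$, $\bar S=[K]\setminus S$, $\bar s=|\bar S|$, and let $\mathcal C_1,\dots,\mathcal C_\kappa$ be a partition of $S$ into nonempty cliques (for distinct $i,i'\in\mathcal C_j$, $(i,i')\in E$). Put $\beta=\kappa+\bar s$; the *meta-nodes* are the indices $j\in[\kappa]$ of the cliques together with the nodes $j\in\bar S$. Loss vectors $\ell_1,\dots,\ell_T\in[0,1]^K$ are fixed in advance. In round $t$ the learner pulls $i_t$, incurs $\ell_{t,i_t}$ and observes $\ell_{t,i}$ for all $i$ with $i_t\in N^{\rm in}(i)$. Let $L_i=\sum_{t=1}^T\ell_{t,i}$, $i^\star\in\arg\min_i L_i$, $L_\star=L_{i^\star}$ and $\mathrm{Reg}=\mathbb E\big[\sum_{t=1}^T\ell_{t,i_t}\big]-L_\star$,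 the expectation being over the learner's randomness. $D_\psi(x,y)=\psi(x)-\psi(y)-\langle\nabla\psi(y),x-y\rangle$ is the Bregman divergence and $\Delta$ a probability simplex. **Adaptive Hedge on $C\subseteq[K]$.** Let $\Omega_C=\{p\in\Delta(K): p_i\ge\frac1{|C|T}\ \forall i\in C,\ p_i=0\ \forall i\notin C\}$. Start with $\widetilde p_1$ uniform on $C$. In round $t$, propose $\widetilde p_t$, receive $\widetilde\ell_t\in\mathbb R_+^K$, and let $\widetilde p_{t+1}=\arg\min_{p\in\Omega_C}\{\langle p,\widetilde\ell_t\rangle+D_{\phi_t}(p,\widetilde p_t)\}$, where $\phi_t(p)=\frac1{\gamma_t}\sum_i p_i\ln p_i$ (with $0\ln 0=0$; only coordinates in $C$ matter) and $\gamma_t=\big(1+\sum_{\tau\le t}\sum_i\widetilde p_{\tau,i}\widetilde\ell_{\tau,i}^2\big)^{-1/2}$. **Algorithm** with parameters $\eta>0$ and $c$. Let $\Omega$ be the set of probability vectors $p$ on the $\beta$ meta-nodes with $p_j\ge\frac1T$ for all $j$, and $$\psi_t(p)=\sum_{j\in[\kappa]}\frac1{\eta_{t,j}}\ln\frac1{p_j}+\frac1\eta\sum_{j\in\bar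 S}p_j\ln p_j+c\sum_{j\in\bar S}\ln\frac1{p_j}.$$ Initialize $\eta_{1,j}=\eta$, $\rho_{1,j}=2\kappa$ for $j\in[\kappa]$, $p_1=\arg\min_{p\in\Omega}\psi_1(p)$, and one adaptive Hedge instance $\mathcal A_j$ on $\mathcal C_j$ for each $j\in[\kappa]$. In round $t=1,\dots,T$: 1. Receive $\widetilde p^{(j)}_t$ from $\mathcal A_j$ for each $j\in[\kappa]$. Sample a meta-node $j_t\sim p_t$. If $j_t\in[\kappa]$ draw $i_t\sim\widetilde p_t^{(j_t)}$, otherwise let $i_t=j_t$. Pull $i_t$ and receive the feedback. 2. For $i\in S$ let $\widetilde\ell_{t,i}=\frac{\ell_{t,i}}{p_{t,j_t}}\mathbf 1\{j_t\in[\kappa],\,i\in\mathcal C_{j_t}\}$; for $i\in\bar S$ let $\widetilde\ell_{t,i}=\frac{\ell_{t,i}}{1-p_{t,i}}\mathbf 1\{i\ne i_t\}$. Feed $\widetilde\ell_t$ to every $\mathcal A_j$. 3. Let $\hat\ell_{t,j}=\langle\widetilde p_t^{(j)},\widetilde\ell_t\rangle$ for $j\in[\kappa]$, $\hat\ell_{t,j}=\widetilde\ell_{t,j}$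 for $j\in\bar S$, and $p_{t+1}=\arg\min_{p\in\Omega}\{\langle p,\hat\ell_t\rangle+D_{\psi_t}(p,p_t)\}$. 4. For each $j\in[\kappa]$: if $\frac1{p_{t+1,j}}>\rho_{t,j}$, set $\rho_{t+1,j}=\frac2{p_{t+1,j}}$ and $\eta_{t+1,j}=\eta_{t,j}e^{1/\ln T}$; otherwise $\rho_{t+1,j}=\rho_{t,j}$ and $\eta_{t+1,j}=\eta_{t,j}$. **Theorem.** There are universal constants $A>0$ and $m\in\mathbb N$ such that the following holds for all $K\ge2$, $T\ge2K$, every strongly observable $G$ on $[K]$, every partition of $S$ into $\kappa$ nonempty cliques, all $\ell_1,\dots,\ell_T\in[0,1]^K$ and every best arm $i^\star$. Let $\eta_{\max}=\min\big\{\frac1{64\beta},\frac1{1000(\ln T)\ln^2(KT)}\big\}$ and run the algorithm with $c=64\beta$. (a) For every $0<\eta\le\eta_{\max}$, $$\mathrm{Reg}\le A\,(\ln(KT))^m\left(\frac{\kappa\ln T+\ln K}{\eta}+\eta L_\star+\beta^2\ln T\right).$$ (b) For $\eta=\min\big\{\eta_{\max},\sqrt{(\kappa+1)/L_\star}\big\}$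 (which is read as $\eta_{\max}$ if $L_\star=0$), $$\mathrm{Reg}\le A\,(\ln(KT))^m\left(\sqrt{(\kappa+1)L_\star}+\beta^2\right).$$ -/

import Mathlib

noncomputable section

namespace GraphBandit

/-! Feedback graphs on the arms `Fin K`. `G.Adj j i` means that playing `j` reveals the loss of
`i`. -/

/-- The set of arms that can observe `i`. -/
def inNbrs {K : ℕ} (G : Digraph (Fin K)) (i : Fin K) : Set (Fin K) := {j | G.Adj j i}

/-- Every node is observable, and it has a self-loop or is observed by all other nodes. -/
def StronglyObservable {K : ℕ} (G : Digraph (Fin K)) : Prop :=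
  ∀ i, (inNbrs G i).Nonempty ∧ (i ∈ inNbrs G i ∨ inNbrs G i = {i}ᶜ)

open Classical in
/-- The set of nodes without a self-loop. -/
def noLoop {K : ℕ} (G : Digraph (Fin K)) : Finset (Fin K) :=
  Finset.univ.filter fun i => ¬ G.Adj i i

/-- A partition into `κ` cliques of the subgraph induced on the nodes with a self-loop. -/
structure CliquePartition {K : ℕ} (G : Digraph (Fin K)) (κ : ℕ) where
  cell : Fin κ → Finset (Fin K)
  nonempty : ∀ j, (cell j).Nonempty
  disjoint : ∀ j j', j ≠ j' → Disjoint (cell j) (cell j')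
  cover : ∀ i, G.Adj i i ↔ ∃ j, i ∈ cell j
  clique : ∀ j, ∀ i ∈ cell j, ∀ i' ∈ cell j, i ≠ i' → G.Adj i i'

/-- The nodes of the meta-graph: the cliques and the nodes without a self-loop. -/
abbrev MetaNode {K : ℕ} (G : Digraph (Fin K)) (κ : ℕ) : Type := Fin κ ⊕ {i // i ∈ noLoop G}

/-- The number of meta-nodes. -/
def beta {K : ℕ} (G : Digraph (Fin K)) (κ : ℕ) : ℕ := κ + (noLoop G).card

/-! Convex-analytic notions. -/

/-- A minimizer of `f` over `A` (the unique one in all the uses below; an arbitrary vector if there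
is no minimizer). -/
def argminOn {ι : Type} (A : Set (ι → ℝ)) (f : (ι → ℝ) → ℝ) : ι → ℝ :=
  Classical.epsilon fun p => p ∈ A ∧ IsMinOn f A p

/-- The Bregman divergence `ψ x - ψ y - ⟨∇ψ(y), x - y⟩`. The last term is written as the derivative
of `ψ` at `y` in direction `x - y`, so that the entropy is also covered at points `y` having zero
coordinates at which `x` vanishes as well. -/
def bregman {ι : Type} [Fintype ι] (ψ : (ι → ℝ) → ℝ) (x y : ι → ℝ) : ℝ :=
  ψ x - ψ y - lineDeriv ℝ ψ y (x - y)

theorem bregman_eq_fderiv {ι : Type} [Fintype ι] (ψ : (ι → ℝ) → ℝ) (x y : ι → ℝ)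
    (h : DifferentiableAt ℝ ψ y) : bregman ψ x y = ψ x - ψ y - fderiv ℝ ψ y (x - y) := by
  rw [bregman, h.lineDeriv_eq_fderiv]

/-! Hedge with adaptive learning rates on a set `C` of active arms. -/

/-- The state of a Hedge instance at the beginning of a round: the distribution that it proposes and
the sum, over all earlier rounds and all arms, of probability times squared loss. -/
structure HedgeState (K : ℕ) where
  dist : Fin K → ℝ
  acc : ℝ

/-- The decision set of Hedge. -/
def hedgeDomain {K : ℕ} (T : ℕ) (C : Finset (Fin K)) : Set (Fin K → ℝ) :=
  {p | p ∈ stdSimplex ℝ (Fin K) ∧ (∀ i ∈ C, 1 / ((C.card : ℝ) * T) ≤ p i) ∧ ∀ i, i ∉ C → p i = 0}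

/-- Hedge starts from the uniform distribution on `C`. -/
def hedgeInit {K : ℕ} (C : Finset (Fin K)) : HedgeState K where
  dist := fun i => if i ∈ C then 1 / (C.card : ℝ) else 0
  acc := 0

/-- The negative entropy with learning rate `η`. -/
def hedgeReg {K : ℕ} (η : ℝ) (p : Fin K → ℝ) : ℝ := (1 / η) * ∑ i, p i * Real.log (p i)

/-- One round of Hedge with the loss vector `loss`. -/
def hedgeStep {K : ℕ} (T : ℕ) (C : Finset (Fin K)) (s : HedgeState K) (loss : Fin K → ℝ) :
    HedgeState K :=
  let acc' := s.acc + ∑ i, s.dist i * loss i ^ 2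
  let η := √(1 / (1 + acc'))
  { dist := argminOn (hedgeDomain T C) fun p =>
      ∑ i, p i * loss i + bregman (hedgeReg η) p s.dist
    acc := acc' }

/-! The two-level algorithm. -/

/-- The state of the algorithm at the beginning of a round: the distribution over meta-nodes, the
learning rates and the thresholds of the cliques, and the Hedge instances of the cliques. -/
structure AlgState {K : ℕ} (G : Digraph (Fin K)) (κ : ℕ) where
  p : MetaNode G κ → ℝ
  rate : Fin κ → ℝ
  thr : Fin κ → ℝ
  hedge : Fin κ → HedgeState K

/-- The decision set of the meta-algorithm. -/
def metaDomain {K : ℕ} (G : Digraph (Fin K)) (κ T : ℕ) : Set (MetaNode G κ → ℝ) :=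
  {p | p ∈ stdSimplex ℝ (MetaNode G κ) ∧ ∀ j, 1 / (T : ℝ) ≤ p j}

/-- The hybrid regularizer: log-barrier with the individual learning rates `rate` on the cliques,
entropy with learning rate `η` plus `c` times log-barrier on the nodes without a self-loop. -/
def metaReg {K : ℕ} (G : Digraph (Fin K)) {κ : ℕ} (rate : Fin κ → ℝ) (η c : ℝ)
    (p : MetaNode G κ → ℝ) : ℝ :=
  ∑ j, (1 / rate j) * Real.log (1 / p (.inl j))
    + (1 / η) * ∑ v, p (.inr v) * Real.log (p (.inr v))
    + c * ∑ v, Real.log (1 / p (.inr v))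

/-- The initial state. -/
def algInit {K κ : ℕ} {G : Digraph (Fin K)} (P : CliquePartition G κ) (T : ℕ) (η c : ℝ) :
    AlgState G κ where
  p := argminOn (metaDomain G κ T) (metaReg G (fun _ => η) η c)
  rate := fun _ => η
  thr := fun _ => 2 * (κ : ℝ)
  hedge := fun j => hedgeInit (P.cell j)

/-- The outcome of a round: the sampled meta-node and the arm that is pulled. -/
abbrev Action {K : ℕ} (G : Digraph (Fin K)) (κ : ℕ) : Type := MetaNode G κ × Fin K

/-- The probability of an outcome in state `s`: the meta-node is drawn from `s.p`; in a clique the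
arm is drawn from the distribution of the clique's Hedge instance, otherwise it is the meta-node. -/
def playProb {K κ : ℕ} {G : Digraph (Fin K)} (s : AlgState G κ) (a : Action G κ) : ℝ :=
  s.p a.1 * match a.1 with
    | .inl j => (s.hedge j).dist a.2
    | .inr v => if a.2 = v.1 then 1 else 0

open Classical in
/-- What the learner sees after pulling `i`: the losses of the arms observed by `i`, all other
entries being blanked out with `0`. -/
def feedback {K : ℕ} (G : Digraph (Fin K)) (loss : Fin K → ℝ) (i : Fin K) : Fin K → ℝ :=
  fun v => if G.Adj i v then loss v else 0

/-- The loss estimator for the arms, computed from the feedback `fb`. -/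
def armEstimator {K κ : ℕ} {G : Digraph (Fin K)} (P : CliquePartition G κ) (s : AlgState G κ)
    (fb : Fin K → ℝ) (a : Action G κ) : Fin K → ℝ := fun v =>
  if h : v ∈ noLoop G then
    if v ≠ a.2 then fb v / (1 - s.p (.inr ⟨v, h⟩)) else 0
  else
    match a.1 with
    | .inl j => if v ∈ P.cell j then fb v / s.p (.inl j) else 0
    | .inr _ => 0

/-- The loss estimator for the meta-nodes, computed from the estimator `est` for the arms. -/
def metaEstimator {K κ : ℕ} {G : Digraph (Fin K)} (s : AlgState G κ) (est : Fin K → ℝ) :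
    MetaNode G κ → ℝ
  | .inl j => ∑ i, (s.hedge j).dist i * est i
  | .inr v => est v.1

/-- One round of the algorithm, with loss vector `loss` and outcome `a`. -/
def algStep {K κ : ℕ} {G : Digraph (Fin K)} (P : CliquePartition G κ) (T : ℕ) (η c : ℝ)
    (loss : Fin K → ℝ) (s : AlgState G κ) (a : Action G κ) : AlgState G κ :=
  let est := armEstimator P s (feedback G loss a.2) a
  let p' := argminOn (metaDomain G κ T) fun p =>
    ∑ j, p j * metaEstimator s est j + bregman (metaReg G s.rate η c) p s.p
  { p := p'
    rate := fun j =>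
      if s.thr j < 1 / p' (.inl j) then s.rate j * Real.exp (1 / Real.log T) else s.rate j
    thr := fun j => if s.thr j < 1 / p' (.inl j) then 2 / p' (.inl j) else s.thr j
    hedge := fun j => hedgeStep T (P.cell j) (s.hedge j) est }

/-- The state after `n` rounds, as a function of the outcomes of these rounds. -/
def stateAfter {K κ : ℕ} {G : Digraph (Fin K)} (P : CliquePartition G κ) (T : ℕ) (η c : ℝ)
    (ℓ : ℕ → Fin K → ℝ) : (n : ℕ) → (Fin n → Action G κ) → AlgState G κ
  | 0, _ => algInit P T η c
  | n + 1, h =>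
      algStep P T η c (ℓ n) (stateAfter P T η c ℓ n fun t => h t.castSucc) (h (Fin.last n))

/-- The probability that the outcomes of the first `n` rounds are `h`. -/
def pathProb {K κ : ℕ} {G : Digraph (Fin K)} (P : CliquePartition G κ) (T : ℕ) (η c : ℝ)
    (ℓ : ℕ → Fin K → ℝ) : (n : ℕ) → (Fin n → Action G κ) → ℝ
  | 0, _ => 1
  | n + 1, h =>
      pathProb P T η c ℓ n (fun t => h t.castSucc)
        * playProb (stateAfter P T η c ℓ n fun t => h t.castSucc) (h (Fin.last n))

/-- The total loss of arm `i` over the rounds `0, …, T - 1`. -/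
def totalLoss {K : ℕ} (T : ℕ) (ℓ : ℕ → Fin K → ℝ) (i : Fin K) : ℝ :=
  ∑ t ∈ Finset.range T, ℓ t i

/-- The expected regret of the algorithm against arm `i` after `T` rounds. -/
def regret {K κ : ℕ} {G : Digraph (Fin K)} (P : CliquePartition G κ) (T : ℕ) (η c : ℝ)
    (ℓ : ℕ → Fin K → ℝ) (i : Fin K) : ℝ :=
  ∑ h : Fin T → Action G κ,
    pathProb P T η c ℓ T h * (∑ t : Fin T, ℓ t (h t).2 - totalLoss T ℓ i)

/-- The largest admissible learning rate. -/
def etaMax (K T β : ℕ) : ℝ :=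
  min (1 / (64 * (β : ℝ))) (1 / (1000 * Real.log T * Real.log ((K : ℝ) * T) ^ 2))

/-- The tuned learning rate `min {etaMax, √((κ + 1) / Lstar)}`, where the second term is `∞` if
`Lstar = 0`. -/
def etaTuned (K T β κ : ℕ) (Lstar : ℝ) : ℝ :=
  if Lstar = 0 then etaMax K T β else min (etaMax K T β) (√(((κ : ℝ) + 1) / Lstar))

end GraphBandit

end

namespace GraphBandit

/-! The regret splits into the regret of the meta-algorithm against the meta-node of the best arm
and, when that meta-node is a clique, the regret of the clique's Hedge instance. Both comparators
are point masses shrunk into the decision sets, at a cost that does not grow with `T` in total. The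
estimators are unbiased, so it suffices to bound estimated regrets.

Meta level: the stability term of one round is at most `48 * η` times the learner's own estimated
loss (`stability_le`). Being of first order in the loss, it is moved to the left-hand side and
finally costs `η * Lstar`. The danger is a loop-free node of probability near one, whose estimate
can be huge; subtracting its estimate from all losses removes it. The log-barrier makes such a
shift, which creates negative losses, harmless (`hybrid_stability`).

Clique level: write `Λ = log (K T)`, `N = η log T`, let `R` be the estimated Hedge regret, `U` the
estimated loss of its comparator and `ρ` the final threshold of the clique. The adaptive rates give
`R ≲ Λ √(1 + acc)`. Since `1 / p` stays below `ρ` after the first round, `acc ≲ ρ (R + U)`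
(`acc_le`). Solving for `R` leaves terms in `ρ / N` with small coefficients and a term `N Λ² U`
(`le_of_sq_le`). The threshold may be of order `T`, so the first terms must be cancelled. That is
the role of the increasing learning rates: an increase lowers the divergence to the comparator, and
the last one alone puts `-ρ / (64 N)` into the meta bound (`algStep_gain`,
`pathSum_metaGap_add_thr_le`). The rates nevertheless stay below `8 * η`, because every increase at
least doubles a threshold confined between `2κ` and `2T` (`Valid.rate_le`).

As `ρ` is random, the cancellation is carried out on each path (`pathSum_gap_le`). Only quantities
linear in the estimators remain to be averaged (`regret_le_of_pathSum_le`), and `U` then contributes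
`Lstar`. Part (b) follows by balancing `(κ + 1) / η` against `η * Lstar`. -/

/-! ### Mirror descent with separable regularizers. -/

theorem argminOn_spec {ι : Type} {A : Set (ι → ℝ)} {f : (ι → ℝ) → ℝ} (hA : IsCompact A)
    (hne : A.Nonempty) (hf : ContinuousOn f A) :
    argminOn A f ∈ A ∧ IsMinOn f A (argminOn A f) :=
  Classical.epsilon_spec (p := fun p => p ∈ A ∧ IsMinOn f A p) (hA.exists_isMinOn hne hf)

/-- The derivative of a separable function along a line. -/
theorem hasDerivAt_sum_line {ι : Type} [Fintype ι] {φ : ι → ℝ → ℝ} {d : ι → ℝ} {y v : ι → ℝ}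
    (hd : ∀ j, HasDerivAt (φ j) (d j) (y j) ∨ v j = 0) :
    HasDerivAt (fun s : ℝ => ∑ j, φ j (y j + s * v j)) (∑ j, d j * v j) 0 := by
  refine HasDerivAt.fun_sum fun j _ => ?_
  rcases hd j with h | h
  · have h1 : HasDerivAt (fun s : ℝ => y j + s * v j) (v j) 0 := by
      simpa using ((hasDerivAt_id (0 : ℝ)).mul_const (v j)).const_add (y j)
    have h2 : HasDerivAt (φ j) (d j) (y j + 0 * v j) := by simpa using h
    exact h2.comp (0 : ℝ) h1
  · simpa [h] using hasDerivAt_const (0 : ℝ) (φ j (y j))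

/-- The first order optimality condition for a separable function on a convex set. -/
theorem first_order {ι : Type} [Fintype ι] {A : Set (ι → ℝ)} (hA : Convex ℝ A)
    {φ : ι → ℝ → ℝ} {d : ι → ℝ} {p u : ι → ℝ} (hp : p ∈ A) (hu : u ∈ A)
    (hmin : IsMinOn (fun x => ∑ j, φ j (x j)) A p)
    (hd : ∀ j, HasDerivAt (φ j) (d j) (p j) ∨ u j = p j) :
    0 ≤ ∑ j, d j * (u j - p j) := by
  have hder := hasDerivAt_sum_line (φ := φ) (d := d) (y := p) (v := fun j => u j - p j)
    (fun j => (hd j).imp id fun h => by simp [h])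
  -- The derivative along the segment towards `u` is a limit of right difference quotients, which
  -- are nonnegative by minimality.
  refine ge_of_tendsto ((hasDerivAt_iff_tendsto_slope_zero.1 hder).mono_left
    (nhdsWithin_mono 0 (fun x (hx : x ∈ Set.Ioi (0 : ℝ)) => ne_of_gt hx))) ?_
  filter_upwards [Ioo_mem_nhdsGT (zero_lt_one' ℝ)] with s hs
  have hmem : (fun j => p j + s * (u j - p j)) ∈ A := by
    have := hA hp hu (sub_nonneg.2 hs.2.le) hs.1.le (by ring)
    convert this using 1
    ext j
    simp only [Pi.add_apply, Pi.smul_apply, smul_eq_mul]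
    ring
  have h1 := isMinOn_iff.1 hmin _ hmem
  simp only [smul_eq_mul, zero_add, zero_mul, add_zero]
  exact mul_nonneg (inv_nonneg.2 hs.1.le) (sub_nonneg.2 h1)

/-- The Bregman divergence of a function on the line with derivative `φ'`. -/
noncomputable def coordBreg (φ φ' : ℝ → ℝ) (x y : ℝ) : ℝ := φ x - φ y - φ' y * (x - y)

/-- The alternative `x j = y j` serves coordinates pinned at zero, where `x log x` is not
differentiable: the line is constant there, and the junk value of `φ' j` is multiplied by zero. -/
theorem bregman_eq_sum {ι : Type} [Fintype ι] {ψ : (ι → ℝ) → ℝ} {φ φ' : ι → ℝ → ℝ}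
    (hψ : ∀ p, ψ p = ∑ j, φ j (p j)) {x y : ι → ℝ}
    (hd : ∀ j, HasDerivAt (φ j) (φ' j (y j)) (y j) ∨ x j = y j) :
    bregman ψ x y = ∑ j, coordBreg (φ j) (φ' j) (x j) (y j) := by
  have hder := hasDerivAt_sum_line (φ := φ) (d := fun j => φ' j (y j)) (y := y)
    (v := fun j => x j - y j) (fun j => (hd j).imp id fun h => by simp [h])
  have : lineDeriv ℝ ψ y (x - y) = ∑ j, φ' j (y j) * (x j - y j) := by
    rw [lineDeriv]
    have e : (fun s : ℝ => ψ (y + s • (x - y)))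
        = fun s : ℝ => ∑ j, φ j (y j + s * (x j - y j)) := by
      funext s
      simp [hψ]
    rw [e]
    exact hder.deriv
  rw [bregman, this, hψ, hψ]
  simp only [coordBreg, Finset.sum_sub_distrib]

/-- One step of mirror descent with a separable regularizer. -/
theorem mirror_step {ι : Type} [Fintype ι] {A : Set (ι → ℝ)} (hA : Convex ℝ A)
    (hc : IsCompact A) {ψ : (ι → ℝ) → ℝ} {φ φ' : ι → ℝ → ℝ}
    (hψ : ∀ p, ψ p = ∑ j, φ j (p j))
    (hcont : ContinuousOn (fun p : ι → ℝ => ∑ j, φ j (p j)) A)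
    (hd : ∀ x ∈ A, ∀ y ∈ A, ∀ j, HasDerivAt (φ j) (φ' j (y j)) (y j) ∨ x j = y j)
    (l : ι → ℝ) {q u : ι → ℝ} (hq : q ∈ A) (hu : u ∈ A) {p' : ι → ℝ}
    (hp' : p' = argminOn A fun p => ∑ j, p j * l j + bregman ψ p q) :
    p' ∈ A ∧ ∑ j, (q j - u j) * l j ≤
      ∑ j, coordBreg (φ j) (φ' j) (u j) (q j) - ∑ j, coordBreg (φ j) (φ' j) (u j) (p' j)
        + ∑ j, ((q j - p' j) * l j - coordBreg (φ j) (φ' j) (p' j) (q j)) := by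
  set F : (ι → ℝ) → ℝ := fun p => ∑ j, p j * l j + bregman ψ p q with hF
  have hFG : Set.EqOn F (fun p => ∑ j, (p j * l j + coordBreg (φ j) (φ' j) (p j) (q j))) A := by
    intro x hx
    simp only [hF, bregman_eq_sum hψ (hd x hx q hq), Finset.sum_add_distrib]
  have hFc : ContinuousOn F A := by
    refine ContinuousOn.congr ?_ hFG
    have h1 : ContinuousOn (fun p : ι → ℝ => (∑ j, φ j (p j)) +
        ∑ j, (p j * l j - φ j (q j) - φ' j (q j) * (p j - q j))) A :=
      hcont.add (Continuous.continuousOn (by fun_prop))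
    refine h1.congr fun x _ => ?_
    simp only [coordBreg, ← Finset.sum_add_distrib]
    exact Finset.sum_congr rfl fun j _ => by ring
  obtain ⟨hmem, hmin⟩ := argminOn_spec hc ⟨q, hq⟩ hFc
  rw [← hp'] at hmem hmin
  refine ⟨hmem, ?_⟩
  have hmin' : IsMinOn (fun p => ∑ j, (fun j x => x * l j + coordBreg (φ j) (φ' j) x (q j))
      j (p j)) A p' := by
    rw [isMinOn_iff] at hmin ⊢
    intro x hx
    have := hmin x hx
    rwa [hFG hx, hFG hmem] at this
  have h0 := first_order (d := fun j => l j + (φ' j (p' j) - φ' j (q j))) hA hmem hu hmin' (by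
    intro j
    refine (hd u hu p' hmem j).imp (fun h => ?_) id
    have e1 : HasDerivAt (fun x : ℝ => x * l j) (l j) (p' j) := by
      simpa using (hasDerivAt_id (p' j)).mul_const (l j)
    have e2 : HasDerivAt (fun x : ℝ => φ' j (q j) * (x - q j)) (φ' j (q j)) (p' j) := by
      simpa using ((hasDerivAt_id (p' j)).sub_const (q j)).const_mul (φ' j (q j))
    exact e1.add ((h.sub_const (φ j (q j))).sub e2))
  -- Three-point identity: the difference of the two sides is exactly the first-order expression
  -- `h0`.
  rw [← sub_nonneg]
  refine h0.trans_eq ?_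
  rw [← Finset.sum_sub_distrib, ← Finset.sum_add_distrib, ← Finset.sum_sub_distrib]
  refine Finset.sum_congr rfl fun j _ => ?_
  simp only [coordBreg]
  ring

/-! Scalar inequalities. -/

theorem sub_one_sub_log_nonneg {y : ℝ} (hy : 0 < y) : 0 ≤ y - 1 - Real.log y := by
  linarith [Real.log_le_sub_one_of_pos hy]

/-- The tangent of `log` at `2` gives slope `1/2` and intercept `-log 2 > -7/10`. It makes the
barrier divergence grow linearly in `y`. -/
theorem half_sub_le_sub_one_sub_log {y : ℝ} (hy : 0 < y) :
    y / 2 - 7 / 10 ≤ y - 1 - Real.log y := by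
  have h := Real.log_le_sub_one_of_pos (half_pos hy)
  rw [Real.log_div hy.ne' two_ne_zero] at h
  linarith [Real.log_two_lt_d9]

/-- With `z = r * p * l` and `y = x / p`, the inequality `log (y (1 + z)) ≤ y (1 + z) - 1`
eliminates `y` and leaves `z - log (1 + z)`, which is quadratic as long as `z ≥ -1/2`. -/
theorem logBarrier_stability {p x r l : ℝ} (hp : 0 < p) (hx : 0 < x) (hr : 0 < r)
    (hl : -(1 / 2) ≤ r * p * l) :
    (p - x) * l - 1 / r * (x / p - 1 - Real.log (x / p)) ≤ 2 * r * p ^ 2 * l ^ 2 := by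
  set z := r * p * l with hz
  set y := x / p with hy
  have hy0 : 0 < y := div_pos hx hp
  have hxy : x = p * y := by rw [hy]; field_simp
  have hz1 : 0 < 1 + z := by linarith
  have h1 := Real.log_le_sub_one_of_pos (mul_pos hy0 hz1)
  rw [Real.log_mul hy0.ne' hz1.ne'] at h1
  have h2 := Real.one_sub_inv_le_log_of_pos hz1
  have h3 : z - (1 - (1 + z)⁻¹) ≤ 2 * z ^ 2 := by
    have : z - (1 - (1 + z)⁻¹) = z ^ 2 / (1 + z) := by field_simp; ring
    rw [this, div_le_iff₀ hz1]
    nlinarith [sq_nonneg z]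
  have h4 : (1 - y) * z - (y - 1 - Real.log y) ≤ 2 * z ^ 2 := by nlinarith
  have e1 : (p - x) * l - 1 / r * (y - 1 - Real.log y)
      = 1 / r * ((1 - y) * z - (y - 1 - Real.log y)) := by
    rw [hxy, hz]; field_simp
  have e2 : 2 * r * p ^ 2 * l ^ 2 = 1 / r * (2 * z ^ 2) := by rw [hz]; field_simp
  rw [e1, e2]
  exact mul_le_mul_of_nonneg_left h4 (by positivity)

theorem entropy_stability_of_neg_one_le {p x η l : ℝ} (hp : 0 < p) (hx : 0 < x) (hη : 0 < η)
    (hl : -1 ≤ η * l) :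
    (p - x) * l - 1 / η * (x * Real.log (x / p) - x + p) ≤ η * p * l ^ 2 := by
  set z := η * l with hz
  set y := x / p with hy
  have hy0 : 0 < y := div_pos hx hp
  have hxy : x = p * y := by rw [hy]; field_simp
  -- Fenchel inequality between the entropy and the exponential; it eliminates `y`.
  have h1 : y * (-z) - y * Real.log y + y ≤ Real.exp (-z) := by
    have h1 := Real.add_one_le_exp (-z - Real.log y)
    rw [Real.exp_sub, Real.exp_log hy0, le_div_iff₀ hy0] at h1
    linarith
  have h2 : z - 1 + Real.exp (-z) ≤ z ^ 2 := by
    rcases le_total z 1 with h | h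
    · have := (abs_le.1 (Real.abs_exp_sub_one_sub_id_le (x := -z) (abs_le.2 (by
        constructor <;> linarith)))).2
      linarith [this, neg_sq z]
    · have : Real.exp (-z) ≤ 1 := Real.exp_le_one_iff.2 (by linarith)
      nlinarith
  have h4 : (1 - y) * z - (y * Real.log y - y + 1) ≤ z ^ 2 := by linarith
  have e1 : (p - x) * l - 1 / η * (x * Real.log y - x + p)
      = p / η * ((1 - y) * z - (y * Real.log y - y + 1)) := by
    rw [hxy, hz]; field_simp
  have e2 : η * p * l ^ 2 = p / η * z ^ 2 := by rw [hz]; field_simp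
  rw [e1, e2]
  exact mul_le_mul_of_nonneg_left h4 (by positivity)

theorem entropy_nonneg {x p : ℝ} (hp : 0 < p) (hx : 0 ≤ x) :
    0 ≤ x * Real.log (x / p) - x + p := by
  rcases hx.eq_or_lt with rfl | hx
  · simpa using hp.le
  have h1 := Real.one_sub_inv_le_log_of_pos (div_pos hx hp)
  have h2 := mul_le_mul_of_nonneg_left h1 hx.le
  have h3 : x * (1 - (x / p)⁻¹) = x - p := by field_simp
  linarith

/-- The entropy alone controls losses with `η * l ≥ -1`. Below that, the small-step part is paid by
`η * p * l ^ 2 ≥ -(p * l)`, and a large multiplicative step is paid by the log-barrier, since `p * l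
≥ -1`. -/
theorem hybrid_stability {p x η c l : ℝ} (hp : 0 < p) (hx : 0 < x) (hη : 0 < η) (hc : 4 ≤ c)
    (hl : -1 ≤ p * l) :
    (p - x) * l - (1 / η * (x * Real.log (x / p) - x + p) + c * (x / p - 1 - Real.log (x / p)))
      ≤ η * p * l ^ 2 := by
  have hy0 : 0 < x / p := div_pos hx hp
  have hh := sub_one_sub_log_nonneg hy0
  rcases le_or_gt (-1) (η * l) with h | h
  · have := entropy_stability_of_neg_one_le hp hx hη h
    nlinarith
  have hg := mul_nonneg (one_div_pos.2 hη).le (entropy_nonneg hp hx.le)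
  have hl0 : l < 0 := by
    by_contra hcon
    nlinarith [mul_nonneg hη.le (not_lt.1 hcon)]
  have e1 : (p - x) * l = (x / p - 1) * -(p * l) := by field_simp; ring
  have hpl : 0 ≤ -(p * l) := by nlinarith
  have hr : -(p * l) ≤ η * p * l ^ 2 := by
    nlinarith [mul_nonneg hpl (by linarith : 0 ≤ -(η * l) - 1)]
  rw [e1]
  set y := x / p
  rcases le_total y 2 with hy | hy
  -- If `p` at most doubles, the gain is at most `-(p * l)`, covered by `hr`; otherwise `y - 1` is
  -- at most four barrier divergences, hence the requirement `4 ≤ c`.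
  · have : (y - 1) * -(p * l) ≤ -(p * l) := by nlinarith
    nlinarith [mul_nonneg (by linarith : 0 ≤ c) hh]
  · have h5 := half_sub_le_sub_one_sub_log hy0
    have h6 : y - 1 ≤ 4 * (y - 1 - Real.log y) := by linarith
    have h7 : (y - 1) * -(p * l) ≤ y - 1 := by nlinarith
    nlinarith [mul_nonneg (by linarith : 0 ≤ c - 4) hh]

/-- A quadratic inequality solved for its unknown. -/
theorem le_of_sq_le {R M B U ρ N : ℝ} (hM : 0 ≤ M) (hB : 0 ≤ B) (hU : 0 ≤ U) (hρ : 0 ≤ ρ)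
    (hN : 0 < N) (h : R ≤ M * √(1 + (B ^ 2 + ρ * (R + U)))) :
    R ≤ M ^ 2 * ρ + M * (1 + B) + (ρ / (200 * N) + 50 * N * M ^ 2 * U) := by
  set W := ρ / (200 * N) + 50 * N * M ^ 2 * U with hW
  have hW0 : 0 ≤ W := by positivity
  -- AM-GM, with weights satisfying `4 * (1/200) * 50 = 1`; the share `ρ / (200 N)` is small enough
  -- to be absorbed later by `ρ / (64 N)`.
  have hW2 : M ^ 2 * ρ * U ≤ W ^ 2 := by
    have e : M ^ 2 * ρ * U = 4 * (ρ / (200 * N)) * (50 * N * M ^ 2 * U) := by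
      field_simp; ring
    rw [e, hW]
    nlinarith [sq_nonneg (ρ / (200 * N) - 50 * N * M ^ 2 * U)]
  by_contra! hcon
  have hX : 0 ≤ M * (1 + B) := by positivity
  have hMρ : 0 ≤ M ^ 2 * ρ := by positivity
  have hR0 : 0 < R := by linarith
  have hsq : R ^ 2 ≤ M ^ 2 * (1 + (B ^ 2 + ρ * (R + U))) := by
    have h2 := pow_le_pow_left₀ hR0.le h 2
    rwa [mul_pow, Real.sq_sqrt (by positivity)] at h2
  have h3 : M ^ 2 * (1 + B ^ 2) ≤ (M * (1 + B)) ^ 2 := by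
    rw [mul_pow]
    exact mul_le_mul_of_nonneg_left (by nlinarith) (sq_nonneg M)
  -- Under the negated goal both `R` and `R - M² ρ` exceed `M (1 + B) + W`, while `hsq` bounds their
  -- product by `(M (1 + B))² + W²`.
  have h4 : (M * (1 + B) + W) * (M * (1 + B) + W) < R * (R - M ^ 2 * ρ) :=
    mul_lt_mul'' (by linarith) (by linarith) (by linarith) (by linarith)
  nlinarith [mul_nonneg hX hW0]

/-! Hedge. -/

theorem isCompact_of_subset_stdSimplex {ι : Type} [Fintype ι] {A : Set (ι → ℝ)}
    (h : A ⊆ stdSimplex ℝ ι) (hc : IsClosed A) : IsCompact A :=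
  (isCompact_stdSimplex ℝ ι).of_isClosed_subset hc h

theorem convex_hedgeDomain {K T : ℕ} {C : Finset (Fin K)} : Convex ℝ (hedgeDomain T C) := by
  intro x hx y hy a b ha hb hab
  refine ⟨convex_stdSimplex ℝ _ hx.1 hy.1 ha hb hab, fun i hi => ?_, fun i hi => ?_⟩
  · have h1 := mul_le_mul_of_nonneg_left (hx.2.1 i hi) ha
    have h2 := mul_le_mul_of_nonneg_left (hy.2.1 i hi) hb
    have h3 : a * (1 / ((C.card : ℝ) * T)) + b * (1 / ((C.card : ℝ) * T))
      = 1 / ((C.card : ℝ) * T) := by rw [← add_mul, hab, one_mul]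
    simp only [Pi.add_apply, Pi.smul_apply, smul_eq_mul]
    linarith
  · simp [hx.2.2 i hi, hy.2.2 i hi]

theorem isCompact_hedgeDomain {K T : ℕ} {C : Finset (Fin K)} :
    IsCompact (hedgeDomain (K := K) T C) := by
  refine isCompact_of_subset_stdSimplex (fun _ h => h.1) ?_
  have e : hedgeDomain (K := K) T C = stdSimplex ℝ (Fin K) ∩
      ((⋂ i ∈ C, {p | 1 / ((C.card : ℝ) * T) ≤ p i}) ∩ ⋂ i, ⋂ (_ : i ∉ C), {p | p i = 0}) := by
    ext p
    simp only [hedgeDomain, Set.mem_ofPred_eq, Set.mem_inter_iff, Set.mem_iInter]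
  rw [e]
  refine (isClosed_stdSimplex ℝ _).inter (IsClosed.inter ?_ ?_)
  · exact isClosed_biInter fun i _ => isClosed_le continuous_const (continuous_apply i)
  · exact isClosed_iInter fun i => isClosed_iInter fun _ =>
      isClosed_eq (continuous_apply i) continuous_const

theorem hedgeDomain_pos {K T : ℕ} {C : Finset (Fin K)} (hT : 0 < T) {p : Fin K → ℝ}
    (hp : p ∈ hedgeDomain T C) {i : Fin K} (hi : i ∈ C) : 0 < p i := by
  have hC : 0 < C.card := Finset.card_pos.2 ⟨i, hi⟩
  exact lt_of_lt_of_le (by positivity) (hp.2.1 i hi)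

/-- Relative entropy, in a form that is nonnegative termwise. -/
noncomputable def relEntropy {K : ℕ} (u p : Fin K → ℝ) : ℝ := ∑ i, (u i * Real.log (u i / p i) - u i + p i)

theorem relEntropy_nonneg {K T : ℕ} {C : Finset (Fin K)} (hT : 0 < T) {u p : Fin K → ℝ}
    (hu : u ∈ hedgeDomain T C) (hp : p ∈ hedgeDomain T C) : 0 ≤ relEntropy u p := by
  refine Finset.sum_nonneg fun i _ => ?_
  by_cases hi : i ∈ C
  · exact entropy_nonneg (hedgeDomain_pos hT hp hi) (hedgeDomain_pos hT hu hi).le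
  · simp [hu.2.2 i hi, hp.2.2 i hi]

/-- The linear terms cancel because both masses are one, and every ratio is at most `|C| T`, by the
floor in the decision set. -/
theorem relEntropy_le {K T : ℕ} {C : Finset (Fin K)} (hT : 0 < T) {u p : Fin K → ℝ}
    (hu : u ∈ hedgeDomain T C) (hp : p ∈ hedgeDomain T C) :
    relEntropy u p ≤ Real.log ((K : ℝ) * T) := by
  have h1 : relEntropy u p = ∑ i, u i * Real.log (u i / p i) := by
    simp only [relEntropy, Finset.sum_add_distrib, Finset.sum_sub_distrib, hu.1.2, hp.1.2]
    ring
  have h2 : ∑ i, u i * Real.log (u i / p i) ≤ ∑ i, u i * Real.log ((K : ℝ) * T) := by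
    refine Finset.sum_le_sum fun i _ => ?_
    by_cases hi : i ∈ C
    · have hu0 := hedgeDomain_pos hT hu hi
      have hp0 := hedgeDomain_pos hT hp hi
      refine mul_le_mul_of_nonneg_left (Real.log_le_log (div_pos hu0 hp0) ?_) hu0.le
      have hC : 0 < C.card := Finset.card_pos.2 ⟨i, hi⟩
      have hCK : C.card ≤ K := by simpa using Finset.card_le_univ C
      have hu1 : u i ≤ 1 := (Finset.single_le_sum (fun j _ => hu.1.1 j)
        (Finset.mem_univ i)).trans_eq hu.1.2
      have h3 := hp.2.1 i hi
      rw [div_le_iff₀ (by positivity)] at h3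
      rw [div_le_iff₀ hp0]
      have h4 : p i * ((C.card : ℝ) * T) ≤ p i * ((K : ℝ) * T) := by gcongr
      linarith
    · simp [hu.2.2 i hi]
  rw [h1]
  refine h2.trans_eq ?_
  rw [← Finset.sum_mul, hu.1.2, one_mul]

/-- One step of a telescoping bound with potential `√(1 + acc) * relEntropy`. Replacing the old
inverse rate by the new one costs `Λ` times their difference, and the stability term costs twice
that difference. -/
theorem hedgeStep_dist {K T : ℕ} {C : Finset (Fin K)} (hT : 0 < T) {s : HedgeState K}
    (hs : s.dist ∈ hedgeDomain T C) (hacc : 0 ≤ s.acc) {loss : Fin K → ℝ} (hl : ∀ i, 0 ≤ loss i)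
    {u : Fin K → ℝ} (hu : u ∈ hedgeDomain T C) {Λ : ℝ} (hΛ : relEntropy u s.dist ≤ Λ) :
    (hedgeStep T C s loss).dist ∈ hedgeDomain T C ∧ s.acc ≤ (hedgeStep T C s loss).acc ∧
    ∑ i, (s.dist i - u i) * loss i
        + √(1 + (hedgeStep T C s loss).acc) * relEntropy u (hedgeStep T C s loss).dist
      ≤ √(1 + s.acc) * relEntropy u s.dist
        + (√(1 + (hedgeStep T C s loss).acc) - √(1 + s.acc)) * (Λ + 2) := by
  set acc' := (hedgeStep T C s loss).acc with hacc'
  have hx : acc' = s.acc + ∑ i, s.dist i * loss i ^ 2 := rfl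
  have hx0 : 0 ≤ ∑ i, s.dist i * loss i ^ 2 :=
    Finset.sum_nonneg fun i _ => mul_nonneg (hs.1.1 i) (sq_nonneg _)
  have hmono : s.acc ≤ acc' := by linarith
  set r := √(1 + s.acc) with hr
  set r' := √(1 + acc') with hr'
  have hr1 : 0 < r := Real.sqrt_pos.2 (by linarith)
  have hr'1 : 0 < r' := Real.sqrt_pos.2 (by linarith)
  have hrr' : r ≤ r' := Real.sqrt_le_sqrt (by linarith)
  have hγ : √(1 / (1 + acc')) = 1 / r' := by
    rw [Real.sqrt_div zero_le_one, Real.sqrt_one]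
  have hγ0 : 0 < 1 / r' := by positivity
  obtain ⟨hmem, hreg⟩ := mirror_step (A := hedgeDomain T C) convex_hedgeDomain
    isCompact_hedgeDomain
    (ψ := hedgeReg (1 / r')) (φ := fun _ x => r' * (x * Real.log x))
    (φ' := fun _ x => r' * (Real.log x + 1)) (by
      intro p
      rw [hedgeReg, one_div_one_div, Finset.mul_sum]) (by
      refine Continuous.continuousOn (continuous_finsetSum _ fun i _ => ?_)
      exact (Real.continuous_mul_log.comp (continuous_apply i)).const_mul _ ) (by
      intro x hx y hy i
      by_cases hi : i ∈ C
      · exact .inl ((Real.hasDerivAt_mul_log (hedgeDomain_pos hT hy hi).ne').const_mul _)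
      · exact .inr (by rw [hx.2.2 i hi, hy.2.2 i hi])) loss hs hu
      (p' := (hedgeStep T C s loss).dist) (by rw [← hγ]; rfl)
  refine ⟨hmem, hmono, ?_⟩
  set p' := (hedgeStep T C s loss).dist
  have hcb : ∀ x ∈ hedgeDomain T C, ∀ y ∈ hedgeDomain T C, ∀ i,
      coordBreg (fun x => r' * (x * Real.log x)) (fun x => r' * (Real.log x + 1)) (x i) (y i)
        = r' * (x i * Real.log (x i / y i) - x i + y i) := by
    intro x hx y hy i
    by_cases hi : i ∈ C
    · rw [Real.log_div (hedgeDomain_pos hT hx hi).ne' (hedgeDomain_pos hT hy hi).ne', coordBreg]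
      ring
    · simp [coordBreg, hx.2.2 i hi, hy.2.2 i hi]
  have hKL : ∀ y ∈ hedgeDomain T C, ∑ i, coordBreg (fun x => r' * (x * Real.log x))
      (fun x => r' * (Real.log x + 1)) (u i) (y i) = r' * relEntropy u y := by
    intro y hy
    rw [relEntropy, Finset.mul_sum]
    exact Finset.sum_congr rfl fun i _ => hcb u hu y hy i
  have hstab : ∑ i, ((s.dist i - p' i) * loss i - coordBreg (fun x => r' * (x * Real.log x))
      (fun x => r' * (Real.log x + 1)) (p' i) (s.dist i)) ≤ 2 * (r' - r) := by
    have h1 : ∑ i, ((s.dist i - p' i) * loss i - coordBreg (fun x => r' * (x * Real.log x))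
      (fun x => r' * (Real.log x + 1)) (p' i) (s.dist i)) ≤
        ∑ i, 1 / r' * (s.dist i * loss i ^ 2) := by
      refine Finset.sum_le_sum fun i _ => ?_
      rw [hcb p' hmem s.dist hs i]
      by_cases hi : i ∈ C
      · have := entropy_stability_of_neg_one_le (hedgeDomain_pos hT hs hi)
          (hedgeDomain_pos hT hmem hi) hγ0 (l := loss i)
          (by linarith [mul_nonneg hγ0.le (hl i)])
        rwa [one_div_one_div, mul_assoc] at this
      · simp [hmem.2.2 i hi, hs.2.2 i hi]
    rw [← Finset.mul_sum] at h1
    refine h1.trans ?_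
    -- The current round is already counted in the rate, so its stability is `(r'² - r²) / r' ≤ 2
    -- (r' - r)`.
    have e1 : ∑ i, s.dist i * loss i ^ 2 = r' ^ 2 - r ^ 2 := by
      rw [hr, hr', Real.sq_sqrt (by linarith), Real.sq_sqrt (by linarith), hx]; ring
    rw [e1, one_div_mul_eq_div, div_le_iff₀ hr'1]
    nlinarith
  rw [hKL _ hs, hKL _ hmem] at hreg
  nlinarith [mul_le_mul_of_nonneg_left hΛ (sub_nonneg.2 hrr')]

theorem hedgeInit_mem {K T : ℕ} {C : Finset (Fin K)} (hT : 0 < T) (hC : C.Nonempty) :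
    (hedgeInit C).dist ∈ hedgeDomain T C := by
  have hc : (0 : ℝ) < C.card := by exact_mod_cast hC.card_pos
  have hT1 : (1 : ℝ) ≤ T := by exact_mod_cast hT
  refine ⟨⟨fun i => ?_, ?_⟩, fun i hi => ?_, fun i hi => ?_⟩
  · simp only [hedgeInit]; split_ifs <;> positivity
  · simp only [hedgeInit, Finset.sum_ite_mem, Finset.univ_inter, Finset.sum_const, nsmul_eq_mul]
    field_simp
  · simp only [hedgeInit, hi, if_true]
    exact one_div_le_one_div_of_le hc (by nlinarith)
  · simp [hedgeInit, hi]

/-- The comparator for Hedge: the point mass at `i`, shrunk into the decision set. -/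
noncomputable def hedgeComparator {K : ℕ} (T : ℕ) (C : Finset (Fin K)) (i : Fin K) : Fin K → ℝ := fun v =>
  1 / (T : ℝ) * (hedgeInit C).dist v + (1 - 1 / (T : ℝ)) * (if v = i then 1 else 0)

theorem hedgeComparator_mem {K T : ℕ} {C : Finset (Fin K)} (hT : 0 < T) {i : Fin K} (hi : i ∈ C) :
    hedgeComparator T C i ∈ hedgeDomain T C := by
  have hT1 : (1 : ℝ) ≤ T := by exact_mod_cast hT
  have h1 : 1 / (T : ℝ) ≤ 1 := by rw [div_le_one (by linarith)]; exact hT1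
  have hm := hedgeInit_mem (T := T) hT ⟨i, hi⟩
  have h0 : ∀ v, 0 ≤ (1 - 1 / (T : ℝ)) * (if v = i then 1 else 0) := fun v =>
    mul_nonneg (by linarith) (by split_ifs <;> norm_num)
  refine ⟨⟨fun v => ?_, ?_⟩, fun v hv => ?_, fun v hv => ?_⟩
  · have := hm.1.1 v
    exact add_nonneg (by positivity) (h0 v)
  · simp only [hedgeComparator, Finset.sum_add_distrib, ← Finset.mul_sum, hm.1.2,
      Finset.sum_ite_eq', Finset.mem_univ, if_true]
    ring
  · refine le_trans (le_of_eq ?_) (le_add_of_nonneg_right (h0 v))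
    simp only [hedgeInit, hv, if_true]
    field_simp
  · have : v ≠ i := fun h => hv (h ▸ hi)
    simp [hedgeComparator, hedgeInit, hv, this]

theorem sum_hedgeComparator_le {K T : ℕ} {C : Finset (Fin K)} (hT : 0 < T) {i : Fin K}
    (hi : i ∈ C) {loss : Fin K → ℝ} (hl : ∀ v, loss v ∈ Set.Icc (0 : ℝ) 1) :
    ∑ v, hedgeComparator T C i v * loss v ≤ loss i + 1 / T := by
  have hT1 : (1 : ℝ) ≤ T := by exact_mod_cast hT
  have hm := hedgeInit_mem (T := T) hT ⟨i, hi⟩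
  have e : ∑ v, hedgeComparator T C i v * loss v
      = 1 / (T : ℝ) * ∑ v, (hedgeInit C).dist v * loss v + (1 - 1 / (T : ℝ)) * loss i := by
    simp only [hedgeComparator, add_mul, Finset.sum_add_distrib, Finset.mul_sum, mul_assoc,
      ite_mul, one_mul, zero_mul]
    congr 1
    simp
  have h1 : ∑ v, (hedgeInit C).dist v * loss v ≤ 1 := by
    rw [← hm.1.2]
    exact Finset.sum_le_sum fun v _ => mul_le_of_le_one_right (hm.1.1 v) (hl v).2
  have h2 : 0 ≤ 1 / (T : ℝ) := by positivity
  rw [e]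
  nlinarith [(hl i).1, mul_le_mul_of_nonneg_left h1 h2, mul_nonneg h2 (hl i).1]

/-! The meta-algorithm. -/

section Meta

variable {K κ T : ℕ} {G : Digraph (Fin K)}

theorem card_metaNode : Fintype.card (MetaNode G κ) = beta G κ := by
  simp [beta]

/-- One arm from each clique together with the loop-free arms embeds the meta-nodes into the arms;
self-loops separate the two kinds. -/
theorem beta_le (P : CliquePartition G κ) : beta G κ ≤ K := by
  choose f hf using P.nonempty
  have hloop : ∀ j, G.Adj (f j) (f j) := fun j => (P.cover _).2 ⟨j, hf j⟩
  have hno : ∀ v : {i // i ∈ noLoop G}, ¬ G.Adj v.1 v.1 := fun v => by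
    have := v.2
    simpa [noLoop] using this
  have hinj : Function.Injective (Sum.elim f Subtype.val : MetaNode G κ → Fin K) := by
    rintro (j | v) (j' | v') h
    · by_contra hne
      refine Finset.disjoint_left.1 (P.disjoint j j' fun h' => hne (by rw [h'])) (hf j) ?_
      have h' : f j = f j' := h
      exact h' ▸ hf j'
    · have h' : f j = v'.1 := h
      exact absurd (hloop j) (h' ▸ hno v')
    · have h' : v.1 = f j' := h
      exact absurd (hloop j') (h' ▸ hno v)
    · exact congrArg _ (Subtype.ext h)
  rw [← card_metaNode]
  simpa only [Fintype.card_fin] using Fintype.card_le_of_injective _ hinj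

theorem kappa_le_beta : κ ≤ beta G κ := Nat.le_add_right _ _

theorem convex_metaDomain : Convex ℝ (metaDomain G κ T) := by
  intro x hx y hy a b ha hb hab
  refine ⟨convex_stdSimplex ℝ _ hx.1 hy.1 ha hb hab, fun j => ?_⟩
  have h1 := mul_le_mul_of_nonneg_left (hx.2 j) ha
  have h2 := mul_le_mul_of_nonneg_left (hy.2 j) hb
  have h3 : a * (1 / (T : ℝ)) + b * (1 / (T : ℝ)) = 1 / (T : ℝ) := by
    rw [← add_mul, hab, one_mul]
  simp only [Pi.add_apply, Pi.smul_apply, smul_eq_mul]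
  linarith

theorem isCompact_metaDomain : IsCompact (metaDomain G κ T) := by
  refine isCompact_of_subset_stdSimplex (fun _ h => h.1) ?_
  have e : metaDomain G κ T = stdSimplex ℝ (MetaNode G κ) ∩ ⋂ j, {p | 1 / (T : ℝ) ≤ p j} := by
    ext p
    simp only [metaDomain, Set.mem_ofPred_eq, Set.mem_inter_iff, Set.mem_iInter]
  rw [e]
  exact (isClosed_stdSimplex ℝ _).inter
    (isClosed_iInter fun j => isClosed_le continuous_const (continuous_apply j))

theorem metaDomain_pos (hT : 0 < T) {p : MetaNode G κ → ℝ} (hp : p ∈ metaDomain G κ T)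
    (j : MetaNode G κ) : 0 < p j :=
  lt_of_lt_of_le (by positivity) (hp.2 j)

theorem metaDomain_le_one {p : MetaNode G κ → ℝ} (hp : p ∈ metaDomain G κ T)
    (j : MetaNode G κ) : p j ≤ 1 :=
  (Finset.single_le_sum (fun j _ => hp.1.1 j) (Finset.mem_univ j)).trans_eq hp.1.2

theorem metaDomain_add_le_one {p : MetaNode G κ → ℝ} (hp : p ∈ metaDomain G κ T)
    {j k : MetaNode G κ} (hjk : j ≠ k) : p j + p k ≤ 1 := by
  rw [← hp.1.2, ← Finset.sum_pair hjk]
  exact Finset.sum_le_sum_of_subset_of_nonneg (Finset.subset_univ _) fun i _ _ => hp.1.1 i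

/-- The summands of the hybrid regularizer. -/
noncomputable def metaPhi (rate : Fin κ → ℝ) (η c : ℝ) : MetaNode G κ → ℝ → ℝ
  | .inl j, x => 1 / rate j * -Real.log x
  | .inr _, x => 1 / η * (x * Real.log x) + c * -Real.log x

/-- The derivatives of the summands of the hybrid regularizer. -/
noncomputable def metaPhi' (rate : Fin κ → ℝ) (η c : ℝ) : MetaNode G κ → ℝ → ℝ
  | .inl j, x => 1 / rate j * -x⁻¹
  | .inr _, x => 1 / η * (Real.log x + 1) + c * -x⁻¹

theorem metaReg_eq_sum (rate : Fin κ → ℝ) (η c : ℝ) (p : MetaNode G κ → ℝ) :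
    metaReg G rate η c p = ∑ j, metaPhi rate η c j (p j) := by
  simp only [metaReg, metaPhi, Fintype.sum_sum_type, Finset.sum_add_distrib, Finset.mul_sum,
    one_div, Real.log_inv, add_assoc]

theorem hasDerivAt_metaPhi (rate : Fin κ → ℝ) (η c : ℝ) (j : MetaNode G κ) {x : ℝ} (hx : 0 < x) :
    HasDerivAt (metaPhi rate η c j) (metaPhi' rate η c j x) x := by
  rcases j with j | v
  · exact (Real.hasDerivAt_log hx.ne').neg.const_mul _
  · exact ((Real.hasDerivAt_mul_log hx.ne').const_mul _).add
      ((Real.hasDerivAt_log hx.ne').neg.const_mul _)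

theorem continuousOn_metaPhi (hT : 0 < T) (rate : Fin κ → ℝ) (η c : ℝ) :
    ContinuousOn (fun p : MetaNode G κ → ℝ => ∑ j, metaPhi rate η c j (p j))
      (metaDomain G κ T) := by
  refine continuousOn_finsetSum _ fun j _ p hp => ContinuousAt.continuousWithinAt ?_
  exact ContinuousAt.comp (f := fun p : MetaNode G κ → ℝ => p j)
    (hasDerivAt_metaPhi rate η c j (metaDomain_pos hT hp j)).continuousAt
    (continuous_apply j).continuousAt

/-- The Bregman divergence of the hybrid regularizer. -/
noncomputable def metaDiv (rate : Fin κ → ℝ) (η c : ℝ) (x y : MetaNode G κ → ℝ) : ℝ :=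
  ∑ j, coordBreg (metaPhi rate η c j) (metaPhi' rate η c j) (x j) (y j)

theorem coordBreg_inl (rate : Fin κ → ℝ) (η c : ℝ) (j : Fin κ) {x y : ℝ} (hx : 0 < x)
    (hy : 0 < y) :
    coordBreg (metaPhi (G := G) rate η c (.inl j)) (metaPhi' (G := G) rate η c (.inl j)) x y
      = 1 / rate j * (x / y - 1 - Real.log (x / y)) := by
  rw [Real.log_div hx.ne' hy.ne', coordBreg, metaPhi, metaPhi, metaPhi']
  field_simp
  ring

theorem coordBreg_inr (rate : Fin κ → ℝ) (η c : ℝ) (v : {i // i ∈ noLoop G}) {x y : ℝ}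
    (hx : 0 < x) (hy : 0 < y) :
    coordBreg (metaPhi rate η c (.inr v)) (metaPhi' rate η c (.inr v)) x y
      = 1 / η * (x * Real.log (x / y) - x + y) + c * (x / y - 1 - Real.log (x / y)) := by
  rw [Real.log_div hx.ne' hy.ne', coordBreg, metaPhi, metaPhi, metaPhi']
  field_simp
  ring

theorem coordBreg_meta_nonneg {rate : Fin κ → ℝ} {η c : ℝ} (hr : ∀ j, 0 < rate j) (hη : 0 < η)
    (hc : 0 ≤ c) (j : MetaNode G κ) {x y : ℝ} (hx : 0 < x) (hy : 0 < y) :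
    0 ≤ coordBreg (metaPhi rate η c j) (metaPhi' rate η c j) x y := by
  have hh := sub_one_sub_log_nonneg (div_pos hx hy)
  rcases j with j | v
  · rw [coordBreg_inl rate η c j hx hy]
    exact mul_nonneg (one_div_pos.2 (hr j)).le hh
  · rw [coordBreg_inr rate η c v hx hy]
    exact add_nonneg (mul_nonneg (one_div_pos.2 hη).le (entropy_nonneg hy hx.le))
      (mul_nonneg hc hh)

theorem metaDiv_nonneg (hT : 0 < T) {rate : Fin κ → ℝ} {η c : ℝ} (hr : ∀ j, 0 < rate j)
    (hη : 0 < η) (hc : 0 ≤ c) {x y : MetaNode G κ → ℝ} (hx : x ∈ metaDomain G κ T)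
    (hy : y ∈ metaDomain G κ T) : 0 ≤ metaDiv rate η c x y :=
  Finset.sum_nonneg fun j _ =>
    coordBreg_meta_nonneg hr hη hc j (metaDomain_pos hT hx j) (metaDomain_pos hT hy j)

/-- The change of the divergence when the learning rates change. -/
theorem metaDiv_sub_metaDiv (hT : 0 < T) (rate rate' : Fin κ → ℝ) (η c : ℝ)
    {x y : MetaNode G κ → ℝ} (hx : x ∈ metaDomain G κ T) (hy : y ∈ metaDomain G κ T) :
    metaDiv rate η c x y - metaDiv rate' η c x y = ∑ j : Fin κ, (1 / rate j - 1 / rate' j) *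
      (x (.inl j) / y (.inl j) - 1 - Real.log (x (.inl j) / y (.inl j))) := by
  rw [metaDiv, metaDiv, Fintype.sum_sum_type, Fintype.sum_sum_type]
  have e1 : ∀ (r : Fin κ → ℝ) (j : Fin κ), coordBreg (metaPhi (G := G) r η c (.inl j))
      (metaPhi' (G := G) r η c (.inl j)) (x (.inl j)) (y (.inl j)) = 1 / r j *
      (x (.inl j) / y (.inl j) - 1 - Real.log (x (.inl j) / y (.inl j))) := fun r j =>
    coordBreg_inl r η c j (metaDomain_pos hT hx _) (metaDomain_pos hT hy _)
  have e2 : ∀ (r : Fin κ → ℝ) (v : {i // i ∈ noLoop G}), coordBreg (metaPhi r η c (.inr v))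
      (metaPhi' r η c (.inr v)) (x (.inr v)) (y (.inr v)) = _ := fun r v =>
    coordBreg_inr r η c v (metaDomain_pos hT hx _) (metaDomain_pos hT hy _)
  simp only [e1, e2, sub_mul, Finset.sum_sub_distrib]
  ring

/-- The stability term of the meta-algorithm, after a shift of the losses by a constant. -/
theorem stability_le (hT : 0 < T) {rate : Fin κ → ℝ} {η c : ℝ} (hη : 0 < η) (hη1 : η ≤ 1 / 1000)
    (hr : ∀ j, 0 < rate j) (hr8 : ∀ j, rate j ≤ 8 * η) (hc : 4 ≤ c)
    {p p' l : MetaNode G κ → ℝ} (hp : p ∈ metaDomain G κ T) (hp' : p' ∈ metaDomain G κ T)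
    (hl : ∀ j, 0 ≤ l j) (hl1 : ∀ j, p (.inl j) * l (.inl j) ≤ 1)
    (hl2 : ∀ v, (1 - p (.inr v)) * l (.inr v) ≤ 1) :
    ∑ j, ((p j - p' j) * l j
        - coordBreg (metaPhi rate η c j) (metaPhi' rate η c j) (p' j) (p j))
      ≤ 48 * η * ∑ j, p j * l j := by
  have hp0 := metaDomain_pos hT hp
  have hp'0 := metaDomain_pos hT hp'
  have hp1 := metaDomain_le_one hp
  -- The shift `a` will be `0` or the estimate of the dominant loop-free node. Importance weighting
  -- gives `p * l ≤ 1`, so the quadratic term `p² l²` is of first order.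
  have hinl : ∀ (j : Fin κ) (a : ℝ), 0 ≤ a → p (.inl j) * a ≤ 1 →
      (p (.inl j) - p' (.inl j)) * (l (.inl j) - a) - coordBreg (metaPhi (G := G) rate η c (.inl j))
        (metaPhi' (G := G) rate η c (.inl j)) (p' (.inl j)) (p (.inl j))
        ≤ 16 * η * (p (.inl j) * l (.inl j)) + 16 * η * (a ^ 2 * p (.inl j)) := by
    intro j a ha hpa
    rw [coordBreg_inl rate η c j (hp'0 _) (hp0 _)]
    have hpl := mul_nonneg (hp0 (.inl j)).le (hl (.inl j))
    have hpa0 := mul_nonneg (hp0 (.inl j)).le ha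
    have h1 : rate j * (p (.inl j) * a) ≤ 8 / 1000 * 1 :=
      mul_le_mul (by linarith [hr8 j]) hpa hpa0 (by norm_num)
    have h2 : 0 ≤ rate j * (p (.inl j) * l (.inl j)) := mul_nonneg (hr j).le hpl
    refine (logBarrier_stability (hp0 _) (hp'0 _) (hr j) (by nlinarith)).trans ?_
    have h3 : p (.inl j) ^ 2 * (l (.inl j) - a) ^ 2
        ≤ p (.inl j) * l (.inl j) + a ^ 2 * p (.inl j) := by
      have e : p (.inl j) ^ 2 * (l (.inl j) - a) ^ 2 = (p (.inl j) * l (.inl j)) ^ 2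
        + (p (.inl j)) * (a ^ 2 * p (.inl j))
        - 2 * ((p (.inl j) * l (.inl j)) * (p (.inl j) * a)) := by ring
      have h4 : (p (.inl j)) * (a ^ 2 * p (.inl j)) ≤ a ^ 2 * p (.inl j) :=
        mul_le_of_le_one_left (mul_nonneg (sq_nonneg a) (hp0 _).le) (hp1 _)
      nlinarith [hl1 j, mul_nonneg hpl hpa0]
    have h5 : 0 ≤ p (.inl j) ^ 2 * (l (.inl j) - a) ^ 2 := by positivity
    calc 2 * rate j * p (.inl j) ^ 2 * (l (.inl j) - a) ^ 2
        = 2 * (rate j * (p (.inl j) ^ 2 * (l (.inl j) - a) ^ 2)) := by ring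
      _ ≤ 2 * (8 * η * (p (.inl j) * l (.inl j) + a ^ 2 * p (.inl j))) := by
          refine mul_le_mul_of_nonneg_left ?_ (by norm_num)
          exact mul_le_mul (hr8 j) h3 h5 (by linarith)
      _ = _ := by ring
  have hinr : ∀ (v : {i // i ∈ noLoop G}) (a : ℝ), 0 ≤ a → p (.inr v) * a ≤ 1 →
      p (.inr v) ≤ 1 / 2 →
      (p (.inr v) - p' (.inr v)) * (l (.inr v) - a) - coordBreg (metaPhi rate η c (.inr v))
        (metaPhi' rate η c (.inr v)) (p' (.inr v)) (p (.inr v))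
        ≤ 16 * η * (p (.inr v) * l (.inr v)) + 16 * η * (a ^ 2 * p (.inr v)) := by
    intro v a ha hpa hhalf
    rw [coordBreg_inr rate η c v (hp'0 _) (hp0 _)]
    have hpl := mul_nonneg (hp0 (.inr v)).le (hl (.inr v))
    refine (hybrid_stability (hp0 _) (hp'0 _) hη hc (by linarith)).trans ?_
    -- The estimator divides by `1 - p`, which is at least `1/2` here.
    have h1 : l (.inr v) ≤ 2 := by nlinarith [hl2 v, hl (.inr v)]
    have h2 : (l (.inr v) - a) ^ 2 ≤ 16 * l (.inr v) + 16 * a ^ 2 := by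
      nlinarith [hl (.inr v), mul_nonneg (hl (.inr v)) ha, sq_nonneg a]
    have := mul_le_mul_of_nonneg_left h2 (mul_pos hη (hp0 (.inr v))).le
    linarith
  have hsum0 : 0 ≤ ∑ j, p j * l j :=
    Finset.sum_nonneg fun j _ => mul_nonneg (hp0 j).le (hl j)
  by_cases hbig : ∃ v0 : {i // i ∈ noLoop G}, 1 / 2 < p (.inr v0)
  · obtain ⟨v0, hv0⟩ := hbig
    set σ := l (.inr v0) with hσ
    have hσ0 : 0 ≤ σ := hl _
    have hne : ∀ j, j ≠ .inr v0 → p j * σ ≤ 1 ∧ p j ≤ 1 / 2 := by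
      intro j hj
      have := metaDomain_add_le_one hp hj
      exact ⟨(mul_le_mul_of_nonneg_right (by linarith) hσ0).trans (hl2 v0), by linarith⟩
    -- Both `p` and `p'` have mass one, so subtracting a constant from the losses changes nothing;
    -- afterwards `v0` has loss zero.
    have hshift : ∑ j, ((p j - p' j) * l j
        - coordBreg (metaPhi rate η c j) (metaPhi' rate η c j) (p' j) (p j))
        = ∑ j, ((p j - p' j) * (l j - σ)
        - coordBreg (metaPhi rate η c j) (metaPhi' rate η c j) (p' j) (p j)) := by
      have : ∑ j, (p j - p' j) * σ = 0 := by
        rw [← Finset.sum_mul, Finset.sum_sub_distrib, hp.1.2, hp'.1.2]; ring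
      rw [← sub_eq_zero, ← Finset.sum_sub_distrib, ← this]
      exact Finset.sum_congr rfl fun j _ => by ring
    have hterm : ∀ j ∈ Finset.univ, (p j - p' j) * (l j - σ)
        - coordBreg (metaPhi rate η c j) (metaPhi' rate η c j) (p' j) (p j)
        ≤ 16 * η * (p j * l j) + 16 * η * (σ ^ 2 * (p j - if j = .inr v0 then p j else 0)) := by
      intro j _
      by_cases hj : j = .inr v0
      · subst hj
        have := coordBreg_meta_nonneg (c := c) hr hη (by linarith) (.inr v0)
          (hp'0 (.inr v0)) (hp0 (.inr v0))
        have h2 := mul_nonneg (hp0 (.inr v0)).le (hl (.inr v0))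
        rw [if_pos rfl, ← hσ, sub_self, sub_self, mul_zero, mul_zero, mul_zero]
        nlinarith
      · rw [if_neg hj, sub_zero]
        obtain ⟨h1, h2⟩ := hne j hj
        rcases j with j | v
        · exact hinl j σ hσ0 h1
        · exact hinr v σ hσ0 h1 h2
    rw [hshift]
    refine (Finset.sum_le_sum hterm).trans ?_
    rw [Finset.sum_add_distrib, ← Finset.mul_sum, ← Finset.mul_sum, ← Finset.mul_sum,
      Finset.sum_sub_distrib, hp.1.2, Finset.sum_ite_eq', if_pos (Finset.mem_univ _)]
    -- The shift costs `σ²` times the mass off `v0`. As `(1 - p) σ ≤ 1` this is at most `σ`, hence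
    -- at most twice the loss `p σ` of the dominant node itself. Altogether `16 * (1 + 2) = 48`.
    have h1 : σ ^ 2 * (1 - p (.inr v0)) ≤ 2 * ∑ j, p j * l j := by
      have h2 : p (.inr v0) * σ ≤ ∑ j, p j * l j :=
        Finset.single_le_sum (f := fun j => p j * l j)
          (fun j _ => mul_nonneg (hp0 j).le (hl j)) (Finset.mem_univ _)
      have h3 : σ ^ 2 * (1 - p (.inr v0)) ≤ σ := by nlinarith [hl2 v0]
      nlinarith
    nlinarith
  · push Not at hbig
    have hterm : ∀ j ∈ Finset.univ, (p j - p' j) * l j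
        - coordBreg (metaPhi rate η c j) (metaPhi' rate η c j) (p' j) (p j)
        ≤ 16 * η * (p j * l j) := by
      intro j _
      rcases j with j | v
      · simpa using hinl j 0 le_rfl (by simp)
      · simpa using hinr v 0 le_rfl (by simp) (hbig v)
    refine (Finset.sum_le_sum hterm).trans ?_
    rw [← Finset.mul_sum]
    nlinarith

end Meta

/-! ### Comparators and the first iterate of the meta-algorithm. -/

section Dynamics

variable {K κ T : ℕ} {G : Digraph (Fin K)}

theorem one_le_log {T : ℕ} (hT : 4 ≤ T) : 1 ≤ Real.log T := by
  have h1 : Real.log ((2 : ℝ) ^ 2) ≤ Real.log T :=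
    Real.log_le_log (by norm_num) (by norm_num; exact_mod_cast hT)
  rw [Real.log_pow] at h1
  push_cast at h1
  linarith [Real.log_two_gt_d9]

/-- The comparator for the meta-algorithm: a point mass shrunk into the decision set. -/
noncomputable def metaComparator (T : ℕ) (k : MetaNode G κ) : MetaNode G κ → ℝ := fun j =>
  1 / (T : ℝ) + (1 - (beta G κ : ℝ) / T) * (if j = k then 1 else 0)

theorem metaComparator_mem (hT : 0 < T) (hβ : beta G κ ≤ T) (k : MetaNode G κ) :
    metaComparator T k ∈ metaDomain G κ T := by
  have hT0 : (0 : ℝ) < T := by exact_mod_cast hT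
  have h1 : (beta G κ : ℝ) / T ≤ 1 := by
    rw [div_le_one hT0]; exact_mod_cast hβ
  have h0 : ∀ j, 0 ≤ (1 - (beta G κ : ℝ) / T) * (if j = k then 1 else 0) := fun j =>
    mul_nonneg (by linarith) (by split_ifs <;> norm_num)
  refine ⟨⟨fun j => add_nonneg (by positivity) (h0 j), ?_⟩, fun j => by
    exact le_add_of_nonneg_right (h0 j)⟩
  simp only [metaComparator, Finset.sum_add_distrib, ← Finset.mul_sum, Finset.sum_ite_eq',
    Finset.mem_univ, if_true, Finset.sum_const, Finset.card_univ, card_metaNode, nsmul_eq_mul]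
  ring

/-- The mass `1/2` on `k` is what lets `algStep_gain` turn a small `p k` into a large divergence. -/
theorem half_le_metaComparator (hT : 0 < T) (hβ : 2 * beta G κ ≤ T) (k : MetaNode G κ) :
    1 / 2 ≤ metaComparator T k k := by
  have hT0 : (0 : ℝ) < T := by exact_mod_cast hT
  have h1 : (beta G κ : ℝ) / T ≤ 1 / 2 := by
    rw [div_le_iff₀ hT0]
    have : 2 * (beta G κ : ℝ) ≤ T := by exact_mod_cast hβ
    linarith
  have h2 : 0 < 1 / (T : ℝ) := by positivity
  simp only [metaComparator, if_true]
  linarith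

theorem sum_metaComparator_le (hT : 0 < T) (k : MetaNode G κ)
    {a : MetaNode G κ → ℝ} (ha : ∀ j, a j ∈ Set.Icc (0 : ℝ) 1) :
    ∑ j, metaComparator T k j * a j ≤ a k + (beta G κ : ℝ) / T := by
  have hT0 : (0 : ℝ) < T := by exact_mod_cast hT
  have e : ∑ j, metaComparator T k j * a j
      = 1 / (T : ℝ) * ∑ j, a j + (1 - (beta G κ : ℝ) / T) * a k := by
    simp only [metaComparator, add_mul, Finset.sum_add_distrib, Finset.mul_sum, mul_assoc,
      ite_mul, one_mul, zero_mul]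
    congr 1
    simp
  have h1 : ∑ j, a j ≤ beta G κ := by
    refine (Finset.sum_le_sum fun j _ => (ha j).2).trans_eq ?_
    rw [Finset.sum_const, Finset.card_univ, card_metaNode]
    simp
  have h2 : 1 / (T : ℝ) * ∑ j, a j ≤ beta G κ / T := by
    rw [one_div_mul_eq_div]; gcongr
  have h3 : 0 ≤ (beta G κ : ℝ) / T * a k := mul_nonneg (by positivity) (ha k).1
  rw [e]
  linarith

/-! The initial distribution. -/

/-- Replaces Jensen: summed over at most `K` nodes of total mass at most one, it bounds the entropy
by `1 + log K`. -/
theorem neg_mul_log_le {x K : ℝ} (hx : 0 < x) (hK : 0 < K) :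
    -(x * Real.log x) ≤ 1 / K + x * Real.log K := by
  have h1 := Real.one_sub_inv_le_log_of_pos (mul_pos hx hK)
  rw [Real.log_mul hx.ne' hK.ne'] at h1
  have h2 := mul_le_mul_of_nonneg_left h1 hx.le
  have h3 : x * (1 - (x * K)⁻¹) = x - 1 / K := by field_simp
  linarith

theorem algInit_p_spec (P : CliquePartition G κ) (hT : 0 < T) {η c : ℝ}
    (hne : (metaDomain G κ T).Nonempty) :
    (algInit P T η c).p ∈ metaDomain G κ T ∧ ∀ x ∈ metaDomain G κ T,
      0 ≤ ∑ j, metaPhi' (fun _ => η) η c j ((algInit P T η c).p j)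
        * (x j - (algInit P T η c).p j) := by
  have hfun : metaReg G (fun _ => η) η c
      = fun p : MetaNode G κ → ℝ => ∑ j, metaPhi (fun _ => η) η c j (p j) :=
    funext fun p => metaReg_eq_sum _ _ _ p
  obtain ⟨hmem, hmin⟩ := argminOn_spec isCompact_metaDomain hne
    (continuousOn_metaPhi (G := G) hT (fun _ => η) η c)
  have hp : (algInit P T η c).p = argminOn (metaDomain G κ T)
      (fun p : MetaNode G κ → ℝ => ∑ j, metaPhi (fun _ => η) η c j (p j)) := by
    rw [← hfun]; rfl
  rw [← hp] at hmem hmin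
  exact ⟨hmem, fun x hx => first_order convex_metaDomain hmem hx hmin fun j =>
    .inl (hasDerivAt_metaPhi _ _ _ j (metaDomain_pos hT hmem j))⟩

theorem sum_inr_le_one {p : MetaNode G κ → ℝ} (hp : p ∈ metaDomain G κ T) :
    ∑ v, p (.inr v) ≤ 1 := by
  have h := hp.1.2
  rw [Fintype.sum_sum_type] at h
  have : 0 ≤ ∑ j, p (.inl j) := Finset.sum_nonneg fun j _ => hp.1.1 _
  linarith

/-- The linear part of the divergence has the favourable sign because the initial point minimizes
the regularizer, so only regularizer values remain. The floor `1 / T` bounds the barriers by `log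
T`. -/
theorem metaDiv_algInit_le (P : CliquePartition G κ) (hT : 0 < T) (hK : 0 < K) {η c : ℝ}
    (hη : 0 < η) (hc : 0 ≤ c) {u : MetaNode G κ → ℝ} (hu : u ∈ metaDomain G κ T) :
    metaDiv (fun _ => η) η c u (algInit P T η c).p
      ≤ (κ * Real.log T + Real.log K + 1) / η + c * (noLoop G).card * Real.log T := by
  obtain ⟨hp, hfoc⟩ := algInit_p_spec P hT (η := η) (c := c) ⟨u, hu⟩
  set p := (algInit P T η c).p
  have hK0 : (0 : ℝ) < K := by exact_mod_cast hK
  have hT0 : (0 : ℝ) < T := by exact_mod_cast hT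
  have h1 : metaDiv (fun _ => η) η c u p
      ≤ ∑ j, (metaPhi (fun _ => η) η c j (u j) - metaPhi (fun _ => η) η c j (p j)) := by
    simp only [metaDiv, coordBreg]
    rw [Finset.sum_sub_distrib]
    linarith [hfoc u hu]
  refine h1.trans ?_
  have hη' : 0 < 1 / η := one_div_pos.2 hη
  have hulog : ∀ j, -Real.log (u j) ≤ Real.log T := by
    intro j
    have := Real.log_le_log (by positivity) (hu.2 j)
    rw [one_div, Real.log_inv] at this
    linarith
  have hplog : ∀ j, 0 ≤ -Real.log (p j) := fun j =>
    neg_nonneg.2 (Real.log_nonpos (metaDomain_pos hT hp j).le (metaDomain_le_one hp j))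
  rw [Fintype.sum_sum_type]
  have hinl : ∑ j : Fin κ, (metaPhi (G := G) (fun _ => η) η c (.inl j) (u (.inl j))
      - metaPhi (G := G) (fun _ => η) η c (.inl j) (p (.inl j)))
      ≤ ∑ j : Fin κ, 1 / η * Real.log T := by
    refine Finset.sum_le_sum fun j _ => ?_
    simp only [metaPhi]
    nlinarith [mul_le_mul_of_nonneg_left (hulog (.inl j)) hη'.le,
      mul_nonneg hη'.le (hplog (.inl j))]
  have hinr : ∑ v : {i // i ∈ noLoop G}, (metaPhi (κ := κ) (fun _ => η) η c (.inr v) (u (.inr v))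
      - metaPhi (κ := κ) (fun _ => η) η c (.inr v) (p (.inr v)))
      ≤ ∑ v : {i // i ∈ noLoop G}, (c * Real.log T
        + 1 / η * (1 / K + p (.inr v) * Real.log K)) := by
    refine Finset.sum_le_sum fun v _ => ?_
    simp only [metaPhi]
    have h2 : u (.inr v) * Real.log (u (.inr v)) ≤ 0 :=
      mul_nonpos_of_nonneg_of_nonpos (metaDomain_pos hT hu _).le
        (Real.log_nonpos (metaDomain_pos hT hu _).le (metaDomain_le_one hu _))
    have h3 := neg_mul_log_le (metaDomain_pos hT hp (.inr v)) hK0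
    nlinarith [mul_le_mul_of_nonneg_left (hulog (.inr v)) hc, mul_nonneg hc (hplog (.inr v)),
      mul_le_mul_of_nonneg_left h3 hη'.le, mul_le_mul_of_nonneg_left h2 hη'.le]
  refine (add_le_add hinl hinr).trans ?_
  simp only [Finset.sum_add_distrib, ← Finset.mul_sum, ← Finset.sum_mul, Finset.sum_const,
    Finset.card_univ, Fintype.card_fin, nsmul_eq_mul, Fintype.card_coe]
  have h4 : ((noLoop G).card : ℝ) * (1 / K) ≤ 1 := by
    rw [mul_one_div, div_le_one hK0]
    exact_mod_cast (by simpa using Finset.card_le_univ (noLoop G))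
  have h5 : (∑ v, p (.inr v)) * Real.log K ≤ Real.log K :=
    mul_le_of_le_one_left (Real.log_natCast_nonneg K) (sum_inr_le_one hp)
  have h6 : 1 / η * (((noLoop G).card : ℝ) * (1 / K) + (∑ v, p (.inr v)) * Real.log K)
      ≤ 1 / η * (1 + Real.log K) := mul_le_mul_of_nonneg_left (add_le_add h4 h5) hη'.le
  have e : (κ * Real.log T + Real.log K + 1) / η
      = κ * (1 / η * Real.log T) + 1 / η * (1 + Real.log K) := by ring
  rw [e]
  linarith

/-- The initial threshold `2κ` gives no control of the first iterate, which therefore needs its own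
bound. The first-order condition tested against the uniform distribution bounds the sum of `1 / p`
over the cliques; `c * η ≤ 1` keeps the influence of the other barrier bounded. -/
theorem one_div_algInit_le (P : CliquePartition G κ) (hT : 0 < T) (hK : 0 < K)
    (hβ : beta G κ ≤ T) {η c : ℝ} (hη : 0 < η) (hc : 0 ≤ c) (hcη : c * η ≤ 1) (j : Fin κ) :
    1 / (algInit P T η c).p (.inl j) ≤ beta G κ * (3 * beta G κ + Real.log K) := by
  have hβ0 : 0 < beta G κ := (Nat.zero_lt_of_lt j.2).trans_le kappa_le_beta
  have hb : (0 : ℝ) < beta G κ := by exact_mod_cast hβ0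
  have hT0 : (0 : ℝ) < T := by exact_mod_cast hT
  have hK0 : (0 : ℝ) < K := by exact_mod_cast hK
  have hunif : (fun _ : MetaNode G κ => 1 / (beta G κ : ℝ)) ∈ metaDomain G κ T := by
    refine ⟨⟨fun _ => by positivity, ?_⟩, fun _ => ?_⟩
    · rw [Finset.sum_const, Finset.card_univ, card_metaNode, nsmul_eq_mul]
      field_simp
    · exact one_div_le_one_div_of_le hb (by exact_mod_cast hβ)
  obtain ⟨hp, hfoc⟩ := algInit_p_spec P hT (η := η) (c := c) ⟨_, hunif⟩
  set p := (algInit P T η c).p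
  have h0 := mul_nonneg hη.le (hfoc _ hunif)
  have hp0 := metaDomain_pos hT hp
  rw [Fintype.sum_sum_type, mul_add, Finset.mul_sum, Finset.mul_sum] at h0
  have hinl : ∑ i : Fin κ, η * (metaPhi' (G := G) (fun _ => η) η c (.inl i) (p (.inl i)) *
      (1 / (beta G κ : ℝ) - p (.inl i)))
      = ∑ i : Fin κ, (1 - 1 / (beta G κ : ℝ) * (1 / p (.inl i))) := by
    refine Finset.sum_congr rfl fun i _ => ?_
    have := (hp0 (.inl i)).ne'
    simp only [metaPhi']
    field_simp
    ring
  have hinr : ∑ v : {i // i ∈ noLoop G}, η * (metaPhi' (κ := κ) (fun _ => η) η c (.inr v) (p (.inr v)) *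
      (1 / (beta G κ : ℝ) - p (.inr v)))
      ≤ ∑ v : {i // i ∈ noLoop G}, (1 / K + p (.inr v) * Real.log K + 1 / (beta G κ : ℝ) + 1) := by
    refine Finset.sum_le_sum fun v _ => ?_
    have hq := hp0 (.inr v)
    have hlog : Real.log (p (.inr v)) ≤ 0 := Real.log_nonpos hq.le (metaDomain_le_one hp _)
    have e : η * (metaPhi' (κ := κ) (fun _ => η) η c (.inr v) (p (.inr v)) *
        (1 / (beta G κ : ℝ) - p (.inr v)))
        = 1 / (beta G κ : ℝ) * Real.log (p (.inr v)) - p (.inr v) * Real.log (p (.inr v))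
          + 1 / (beta G κ : ℝ) - p (.inr v) - c * η * (1 / (beta G κ : ℝ)) * (1 / p (.inr v))
          + c * η := by
      have := hq.ne'
      simp only [metaPhi']
      field_simp
      ring
    have h1 : 1 / (beta G κ : ℝ) * Real.log (p (.inr v)) ≤ 0 :=
      mul_nonpos_of_nonneg_of_nonpos (by positivity) hlog
    have h2 : 0 ≤ c * η * (1 / (beta G κ : ℝ)) * (1 / p (.inr v)) := by positivity
    have h3 := neg_mul_log_le hq hK0
    rw [e]
    linarith
  rw [hinl] at h0
  replace h0 := h0.trans (add_le_add le_rfl hinr)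
  simp only [Finset.sum_add_distrib, Finset.sum_sub_distrib, ← Finset.mul_sum, ← Finset.sum_mul,
    Finset.sum_const, Finset.card_univ, Fintype.card_fin, nsmul_eq_mul, Fintype.card_coe] at h0
  have hsingle : 1 / p (.inl j) ≤ ∑ i : Fin κ, 1 / p (.inl i) :=
    Finset.single_le_sum (f := fun i : Fin κ => 1 / p (.inl i))
      (fun i _ => (one_div_pos.2 (hp0 _)).le) (Finset.mem_univ j)
  have h4 : ((noLoop G).card : ℝ) * (1 / K) ≤ 1 := by
    rw [mul_one_div, div_le_one hK0]
    exact_mod_cast (by simpa using Finset.card_le_univ (noLoop G))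
  have h5 : (∑ v, p (.inr v)) * Real.log K ≤ Real.log K :=
    mul_le_of_le_one_left (Real.log_natCast_nonneg K) (sum_inr_le_one hp)
  have hbeq : (beta G κ : ℝ) = κ + (noLoop G).card := by simp [beta]
  have h6 : ((noLoop G).card : ℝ) * (1 / (beta G κ : ℝ)) ≤ 1 := by
    rw [mul_one_div, div_le_one hb, hbeq]
    linarith [(Nat.cast_nonneg κ : (0 : ℝ) ≤ κ)]
  have hb1 : (1 : ℝ) ≤ beta G κ := by exact_mod_cast hβ0
  have h7 : 1 / (beta G κ : ℝ) * ∑ i : Fin κ, 1 / p (.inl i) ≤ 3 * beta G κ + Real.log K := by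
    linarith
  rw [one_div_mul_eq_div, div_le_iff₀ hb] at h7
  linarith

end Dynamics

/-! ### Invariants of the state. -/

section Steps

variable {K κ T : ℕ} {G : Digraph (Fin K)} {P : CliquePartition G κ} {η c : ℝ}

/-- The loss estimator of the arms in state `s` after the outcome `a`. -/
noncomputable def roundEst (P : CliquePartition G κ) (loss : Fin K → ℝ) (s : AlgState G κ)
    (a : Action G κ) : Fin K → ℝ :=
  armEstimator P s (feedback G loss a.2) a

/-- The properties that every state of the algorithm has. -/
structure Valid (P : CliquePartition G κ) (T : ℕ) (η : ℝ) (s : AlgState G κ) : Prop where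
  p_mem : s.p ∈ metaDomain G κ T
  hedge_mem : ∀ j, (s.hedge j).dist ∈ hedgeDomain T (P.cell j)
  acc_nonneg : ∀ j, 0 ≤ (s.hedge j).acc
  le_rate : ∀ j, η ≤ s.rate j
  le_thr : ∀ j, 2 * (κ : ℝ) ≤ s.thr j
  thr_le : ∀ j, s.thr j ≤ 2 * (T : ℝ)
  log_rate_le : ∀ j, Real.log (s.rate j / η) * (Real.log T * Real.log 2)
    ≤ Real.log (s.thr j / (2 * κ))

theorem kappa_pos (j : Fin κ) : (1 : ℝ) ≤ κ := by
  exact_mod_cast Nat.one_le_of_lt j.2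

/-- Thresholds between `2κ` and `2T` give `log (rate / η) * log 2 ≤ 1`, and `1 / log 2 < 3 log 2 =
log 8`. -/
theorem Valid.rate_le {s : AlgState G κ} (hs : Valid P T η s) (hT : 4 ≤ T) (hη : 0 < η)
    (j : Fin κ) : s.rate j ≤ 8 * η := by
  have hκ := kappa_pos j
  have hr : 0 < s.rate j := hη.trans_le (hs.le_rate j)
  have hl := one_le_log hT
  have hT0 : (0 : ℝ) < T := by positivity
  have h2 := Real.log_two_gt_d9
  have hthr : Real.log (s.thr j / (2 * κ)) ≤ Real.log T := by
    refine Real.log_le_log (div_pos (by linarith [hs.le_thr j]) (by linarith)) ?_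
    rw [div_le_iff₀ (by linarith)]
    nlinarith [hs.thr_le j]
  have h1 := (hs.log_rate_le j).trans hthr
  have h3 : Real.log (s.rate j / η) * Real.log 2 ≤ 1 := by
    by_contra! hcon
    nlinarith
  have h4 : Real.log (s.rate j / η) ≤ Real.log 8 := by
    have e : Real.log 8 = 3 * Real.log 2 := by
      rw [show (8 : ℝ) = 2 ^ 3 by norm_num, Real.log_pow]; norm_num
    rw [e]
    by_contra! hcon
    nlinarith
  rw [Real.log_le_log_iff (div_pos hr hη) (by norm_num), div_le_iff₀ hη] at h4
  exact h4

/-! ### Size of the loss estimators. -/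

section Estimator

variable {loss : Fin K → ℝ} {s : AlgState G κ} {a : Action G κ}

theorem feedback_mem (hloss : ∀ i, loss i ∈ Set.Icc (0 : ℝ) 1) (i v : Fin K) :
    feedback G loss i v ∈ Set.Icc (0 : ℝ) 1 := by
  rw [feedback]
  split_ifs
  · exact hloss v
  · simp

theorem roundEst_nonneg (hs : Valid P T η s) (hloss : ∀ i, loss i ∈ Set.Icc (0 : ℝ) 1)
    (v : Fin K) : 0 ≤ roundEst P loss s a v := by
  have hf := (feedback_mem (G := G) hloss a.2 v).1
  rw [roundEst, armEstimator]
  split_ifs with h1 h2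
  · exact div_nonneg hf (by linarith [metaDomain_le_one hs.p_mem (.inr ⟨v, h1⟩)])
  · exact le_rfl
  · rcases a.1 with j | w
    · simp only
      split_ifs
      · exact div_nonneg hf (hs.p_mem.1.1 _)
      · exact le_rfl
    · exact le_rfl

theorem not_mem_cell_of_mem_noLoop (P : CliquePartition G κ) {v : Fin K} (hv : v ∈ noLoop G)
    (j : Fin κ) : v ∉ P.cell j := by
  intro h
  have h1 : ¬ G.Adj v v := by simpa [noLoop] using hv
  exact h1 ((P.cover v).2 ⟨j, h⟩)

theorem mem_cell_unique (P : CliquePartition G κ) {v : Fin K} {j j' : Fin κ}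
    (h : v ∈ P.cell j) (h' : v ∈ P.cell j') : j = j' := by
  by_contra hne
  exact Finset.disjoint_left.1 (P.disjoint j j' hne) h h'

theorem roundEst_cell_le (hT : 0 < T) (hs : Valid P T η s)
    (hloss : ∀ i, loss i ∈ Set.Icc (0 : ℝ) 1) {j : Fin κ} {v : Fin K} (hv : v ∈ P.cell j) :
    s.p (.inl j) * roundEst P loss s a v ≤ 1 := by
  have hf := (feedback_mem (G := G) hloss a.2 v).2
  have hp := metaDomain_pos hT hs.p_mem (.inl j)
  rw [roundEst, armEstimator, dif_neg fun h => not_mem_cell_of_mem_noLoop P h j hv]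
  rcases a.1 with j' | w
  · simp only
    split_ifs with h
    · obtain rfl := mem_cell_unique P hv h
      rwa [mul_div_cancel₀ _ hp.ne']
    · simp
  · simp

theorem roundEst_noLoop_le
    (hloss : ∀ i, loss i ∈ Set.Icc (0 : ℝ) 1) (v : {i // i ∈ noLoop G}) :
    (1 - s.p (.inr v)) * roundEst P loss s a v.1 ≤ 1 := by
  have hf := feedback_mem (G := G) hloss a.2 v.1
  rw [roundEst, armEstimator, dif_pos v.2]
  split_ifs
  · rcases eq_or_ne (1 - s.p (.inr v)) 0 with h | h
    · simp [h]
    · rw [mul_div_cancel₀ _ h]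
      exact hf.2
  · simp

theorem metaEstimator_nonneg (hs : Valid P T η s) {est : Fin K → ℝ} (h : ∀ v, 0 ≤ est v)
    (j : MetaNode G κ) : 0 ≤ metaEstimator s est j := by
  rcases j with j | v
  · exact Finset.sum_nonneg fun i _ => mul_nonneg ((hs.hedge_mem j).1.1 i) (h i)
  · exact h _

theorem metaEstimator_roundEst_inl_le (hT : 0 < T) (hs : Valid P T η s)
    (hloss : ∀ i, loss i ∈ Set.Icc (0 : ℝ) 1) (j : Fin κ) :
    s.p (.inl j) * metaEstimator s (roundEst P loss s a) (.inl j) ≤ 1 := by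
  rw [metaEstimator, Finset.mul_sum, ← (hs.hedge_mem j).1.2]
  refine Finset.sum_le_sum fun i _ => ?_
  by_cases hi : i ∈ P.cell j
  · have h := mul_le_mul_of_nonneg_left (roundEst_cell_le (a := a) hT hs hloss hi)
      ((hs.hedge_mem j).1.1 i)
    linarith
  · simp [(hs.hedge_mem j).2.2 i hi]

end Estimator

/-! One round of the algorithm. -/

section Round

variable {loss : Fin K → ℝ} {s : AlgState G κ} {a : Action G κ}

theorem algStep_meta (hT : 4 ≤ T) (hη : 0 < η) (hη1 : η ≤ 1 / 1000) (hc : 4 ≤ c)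
    (hs : Valid P T η s) (hloss : ∀ i, loss i ∈ Set.Icc (0 : ℝ) 1)
    {u : MetaNode G κ → ℝ} (hu : u ∈ metaDomain G κ T) :
    (algStep P T η c loss s a).p ∈ metaDomain G κ T ∧
    (1 - 48 * η) * ∑ j, s.p j * metaEstimator s (roundEst P loss s a) j
        - ∑ j, u j * metaEstimator s (roundEst P loss s a) j
      ≤ metaDiv s.rate η c u s.p - metaDiv s.rate η c u (algStep P T η c loss s a).p := by
  have hT0 : 0 < T := by omega
  obtain ⟨hmem, hstep⟩ := mirror_step convex_metaDomain isCompact_metaDomain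
    (metaReg_eq_sum (G := G) s.rate η c) (continuousOn_metaPhi hT0 s.rate η c)
    (φ' := metaPhi' s.rate η c)
    (fun x _ y hy j => .inl (hasDerivAt_metaPhi _ _ _ j (metaDomain_pos hT0 hy j)))
    (metaEstimator s (roundEst P loss s a)) hs.p_mem hu
    (p' := (algStep P T η c loss s a).p) rfl
  refine ⟨hmem, ?_⟩
  have hstab := stability_le (c := c) hT0 hη hη1 (fun j => hη.trans_le (hs.le_rate j))
    (hs.rate_le hT hη) hc hs.p_mem hmem
    (l := metaEstimator s (roundEst P loss s a))
    (metaEstimator_nonneg hs fun v => roundEst_nonneg hs hloss v)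
    (metaEstimator_roundEst_inl_le hT0 hs hloss) (roundEst_noLoop_le hloss)
  simp only [sub_mul, Finset.sum_sub_distrib] at hstep hstab
  simp only [metaDiv]
  linarith

/-- The invariant `log_rate_le` counts increases: each adds `1 / log T` to `log rate` and at least
`log 2` to the logarithm of the threshold. The ceiling `2T` comes from the floor `1 / T` on `p`. -/
theorem algStep_valid (hT : 4 ≤ T) (hη : 0 < η) (hη1 : η ≤ 1 / 1000) (hc : 4 ≤ c)
    (hs : Valid P T η s) (hloss : ∀ i, loss i ∈ Set.Icc (0 : ℝ) 1) :
    Valid P T η (algStep P T η c loss s a) := by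
  have hT0 : 0 < T := by omega
  have hl := one_le_log hT
  have hp' := (algStep_meta (a := a) hT hη hη1 hc hs hloss hs.p_mem).1
  have hest : ∀ v, 0 ≤ roundEst P loss s a v := roundEst_nonneg hs hloss
  have hhedge := fun j => hedgeStep_dist hT0 (hs.hedge_mem j) (hs.acc_nonneg j) hest
    (hs.hedge_mem j) le_rfl
  set s' := algStep P T η c loss s a with hs'
  have hthr : ∀ j, s'.thr j = if s.thr j < 1 / s'.p (.inl j) then 2 / s'.p (.inl j)
    else s.thr j := fun j => rfl
  have hrate : ∀ j, s'.rate j = if s.thr j < 1 / s'.p (.inl j) then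
    s.rate j * Real.exp (1 / Real.log T) else s.rate j := fun j => rfl
  have h2 : ∀ j, 2 / s'.p (.inl j) = 2 * (1 / s'.p (.inl j)) := fun j => by ring
  have hexp : 1 ≤ Real.exp (1 / Real.log T) := Real.one_le_exp (by positivity)
  refine ⟨hp', fun j => (hhedge j).1, fun j => (hs.acc_nonneg j).trans (hhedge j).2.1,
    fun j => ?_, fun j => ?_, fun j => ?_, fun j => ?_⟩
  · rw [hrate]
    have := hs.le_rate j
    split_ifs
    · nlinarith
    · exact this
  · rw [hthr]
    have := hs.le_thr j
    split_ifs with h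
    · rw [h2]
      linarith [kappa_pos j]
    · exact this
  · rw [hthr]
    split_ifs with h
    · have hp0 := metaDomain_pos hT0 hp' (.inl j)
      have h3 := hp'.2 (.inl j)
      rw [div_le_iff₀ (by positivity)] at h3
      rw [div_le_iff₀ hp0]
      linarith
    · exact hs.thr_le j
  · rw [hthr, hrate]
    have hκ := kappa_pos j
    have h0 := hs.log_rate_le j
    split_ifs with h
    · have hr : 0 < s.rate j := hη.trans_le (hs.le_rate j)
      have ht : 0 < s.thr j := by linarith [hs.le_thr j]
      have e1 : Real.log (s.rate j * Real.exp (1 / Real.log T) / η)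
          = Real.log (s.rate j / η) + 1 / Real.log T := by
        rw [mul_div_right_comm, Real.log_mul (div_pos hr hη).ne' (Real.exp_pos _).ne',
          Real.log_exp]
      have e2 : Real.log 2 + Real.log (s.thr j / (2 * κ))
          ≤ Real.log (2 / s'.p (.inl j) / (2 * κ)) := by
        rw [← Real.log_mul two_ne_zero (by positivity), ← mul_div_assoc]
        refine Real.log_le_log (by positivity) ?_
        rw [h2]
        gcongr
      rw [e1, add_mul]
      have e3 : 1 / Real.log T * (Real.log T * Real.log 2) = Real.log 2 := by field_simp
      linarith
    · exact h0

/-- The gain from an increase of the learning rates. -/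
theorem algStep_gain (hT : 4 ≤ T) (hη : 0 < η) (hη1 : η ≤ 1 / 1000) (hc : 4 ≤ c)
    (hs : Valid P T η s) (hloss : ∀ i, loss i ∈ Set.Icc (0 : ℝ) 1)
    {u : MetaNode G κ → ℝ} (hu : u ∈ metaDomain G κ T) :
    metaDiv (algStep P T η c loss s a).rate η c u (algStep P T η c loss s a).p
      ≤ metaDiv s.rate η c u (algStep P T η c loss s a).p ∧
    ∀ k, 1 / 2 ≤ u (.inl k) →
      metaDiv (algStep P T η c loss s a).rate η c u (algStep P T η c loss s a).p
        + max 0 ((algStep P T η c loss s a).thr k / (64 * (η * Real.log T)) - κ / η)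
      ≤ metaDiv s.rate η c u (algStep P T η c loss s a).p
        + max 0 (s.thr k / (64 * (η * Real.log T)) - κ / η) := by
  have hT0 : 0 < T := by omega
  have hl := one_le_log hT
  have hv := algStep_valid (a := a) hT hη hη1 hc hs hloss
  set s' := algStep P T η c loss s a with hs'
  have hdiff := metaDiv_sub_metaDiv hT0 s.rate s'.rate η c hu hv.p_mem
  have hrate : ∀ j, s'.rate j = if s.thr j < 1 / s'.p (.inl j) then
    s.rate j * Real.exp (1 / Real.log T) else s.rate j := fun j => rfl
  have hh : ∀ j : Fin κ, 0 < u (.inl j) / s'.p (.inl j) := fun j =>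
    div_pos (metaDomain_pos hT0 hu _) (metaDomain_pos hT0 hv.p_mem _)
  have hexp : 1 / Real.log T + 1 ≤ Real.exp (1 / Real.log T) := Real.add_one_le_exp _
  have hl' : 0 < 1 / Real.log T := by positivity
  have hdr : ∀ j, 0 ≤ 1 / s.rate j - 1 / s'.rate j := by
    intro j
    have hr : 0 < s.rate j := hη.trans_le (hs.le_rate j)
    rw [hrate, sub_nonneg]
    split_ifs
    · exact one_div_le_one_div_of_le hr (by nlinarith)
    · exact le_rfl
  have hterm : ∀ j ∈ Finset.univ, 0 ≤ (1 / s.rate j - 1 / s'.rate j) * (u (.inl j) /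
      s'.p (.inl j) - 1 - Real.log (u (.inl j) / s'.p (.inl j))) := fun j _ =>
    mul_nonneg (hdr j) (sub_one_sub_log_nonneg (hh j))
  have hsum := Finset.sum_nonneg hterm
  refine ⟨by linarith, fun k hk => ?_⟩
  by_cases h : s.thr k < 1 / s'.p (.inl k)
  · have hthr : s'.thr k = 2 / s'.p (.inl k) := if_pos h
    have hsingle := Finset.single_le_sum hterm (Finset.mem_univ k)
    have hr : 0 < s.rate k := hη.trans_le (hs.le_rate k)
    have hr' : s'.rate k = s.rate k * Real.exp (1 / Real.log T) := by rw [hrate, if_pos h]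
    have hr8 := hv.rate_le hT hη k
    have hN : 0 < η * Real.log T := by positivity
    -- From `exp x - 1 ≥ x` with `x = 1 / log T`, and the new rate being at most `8 * η`.
    have h1 : 1 / (8 * (η * Real.log T)) ≤ 1 / s.rate k - 1 / s'.rate k := by
      have e : 1 / s.rate k - 1 / s'.rate k = (Real.exp (1 / Real.log T) - 1) / s'.rate k := by
        rw [hr']; field_simp
      have e2 : 1 / (8 * (η * Real.log T)) = 1 / Real.log T / (8 * η) := by field_simp
      rw [e, e2]
      exact div_le_div₀ (by linarith) (by linarith) (hη.trans_le (hv.le_rate k)) hr8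
    -- The ratio `u / p'` is at least `thr' / 4`, since `u ≥ 1/2` and `thr' = 2 / p'`; the
    -- divergence is at least half the ratio, up to a constant.
    have h2 : s'.thr k / 8 - 7 / 10 ≤ u (.inl k) / s'.p (.inl k) - 1
        - Real.log (u (.inl k) / s'.p (.inl k)) := by
      refine le_trans ?_ (half_sub_le_sub_one_sub_log (hh k))
      have : 1 / 2 / s'.p (.inl k) ≤ u (.inl k) / s'.p (.inl k) := by
        have := metaDomain_pos hT0 hv.p_mem (.inl k)
        gcongr
      have e : s'.thr k = 4 * (1 / 2 / s'.p (.inl k)) := by rw [hthr]; ring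
      rw [e]
      linarith
    have h3 : s'.thr k / (64 * (η * Real.log T)) - κ / η
        ≤ 1 / (8 * (η * Real.log T)) * (s'.thr k / 8 - 7 / 10) := by
      have e : 1 / (8 * (η * Real.log T)) * (s'.thr k / 8 - 7 / 10)
          = s'.thr k / (64 * (η * Real.log T)) - 7 / 80 / Real.log T / η := by
        field_simp; ring
      rw [e]
      have h4 : 7 / 80 / Real.log T ≤ κ := by
        rw [div_le_iff₀ (by linarith)]
        nlinarith [kappa_pos k]
      have : 7 / 80 / Real.log T / η ≤ κ / η := by gcongr
      linarith
    have h4 : s'.thr k / (64 * (η * Real.log T)) - κ / η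
        ≤ ∑ j : Fin κ, (1 / s.rate j - 1 / s'.rate j) * (u (.inl j) /
      s'.p (.inl j) - 1 - Real.log (u (.inl j) / s'.p (.inl j))) := by
      refine (h3.trans ?_).trans hsingle
      refine (mul_le_mul_of_nonneg_left h2 (by positivity)).trans ?_
      exact mul_le_mul_of_nonneg_right h1 (sub_one_sub_log_nonneg (hh k))
    -- A single increase pays for the entire new potential, so the old one is simply discarded; no
    -- sum over increases is needed.
    have h5 := max_le hsum h4
    have h6 := le_max_left 0 (s.thr k / (64 * (η * Real.log T)) - κ / η)
    linarith
  · have hthr : s'.thr k = s.thr k := if_neg h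
    rw [hthr]
    linarith

theorem algStep_thr {j : Fin κ} (h0 : 0 ≤ s.thr j) :
    s.thr j ≤ (algStep P T η c loss s a).thr j ∧
    1 / (algStep P T η c loss s a).p (.inl j) ≤ (algStep P T η c loss s a).thr j := by
  have hthr : (algStep P T η c loss s a).thr j
      = if s.thr j < 1 / (algStep P T η c loss s a).p (.inl j)
        then 2 / (algStep P T η c loss s a).p (.inl j) else s.thr j := rfl
  have h2 : 2 / (algStep P T η c loss s a).p (.inl j)
      = 2 * (1 / (algStep P T η c loss s a).p (.inl j)) := by ring
  rw [hthr]
  split_ifs with h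
  · rw [h2]
    constructor <;> linarith
  · exact ⟨le_rfl, not_lt.1 h⟩

end Round

theorem algInit_valid (P : CliquePartition G κ) (hT : 0 < T) (hK : K ≤ T) (hη : 0 < η)
    (hne : (metaDomain G κ T).Nonempty) : Valid P T η (algInit P T η c) where
  p_mem := (algInit_p_spec P hT hne).1
  hedge_mem j := hedgeInit_mem hT (P.nonempty j)
  acc_nonneg _ := le_rfl
  le_rate _ := le_rfl
  le_thr _ := le_rfl
  thr_le _ := by
    have : (κ : ℝ) ≤ T := by exact_mod_cast (kappa_le_beta.trans (beta_le P)).trans hK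
    simp only [algInit]
    linarith
  log_rate_le j := by
    have hκ := kappa_pos j
    simp only [algInit]
    rw [div_self hη.ne', div_self (by linarith)]
    simp

end Steps

/-! ### Conditional expectations given the state. -/

section Expectation

variable {K κ T : ℕ} {G : Digraph (Fin K)} {P : CliquePartition G κ} {η c : ℝ}

theorem playProb_nonneg {s : AlgState G κ} (hs : Valid P T η s) (a : Action G κ) :
    0 ≤ playProb s a := by
  refine mul_nonneg (hs.p_mem.1.1 _) ?_
  rcases a.1 with j | v
  · exact (hs.hedge_mem j).1.1 _
  · simp only
    split_ifs <;> norm_num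

/-- The pulled arm follows the mixture of the Hedge distributions and the point masses, which
identifies the learner's expected loss with the linear loss of the meta-algorithm. -/
theorem sum_playProb_mul (s : AlgState G κ) (w : Fin K → ℝ) :
    ∑ a, playProb s a * w a.2 = ∑ m, s.p m * metaEstimator s w m := by
  rw [Fintype.sum_prod_type]
  refine Finset.sum_congr rfl fun m _ => ?_
  rcases m with j | v
  · simp only [playProb, metaEstimator, Finset.mul_sum, mul_assoc]
  · simp [playProb, metaEstimator]

theorem metaEstimator_const {s : AlgState G κ} (hs : Valid P T η s) (x : ℝ) (m : MetaNode G κ) :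
    metaEstimator s (fun _ => x) m = x := by
  rcases m with j | v
  · simp only [metaEstimator, ← Finset.sum_mul, (hs.hedge_mem j).1.2, one_mul]
  · rfl

theorem sum_playProb {s : AlgState G κ} (hs : Valid P T η s) : ∑ a, playProb s a = 1 := by
  have := sum_playProb_mul s fun _ => 1
  simpa only [mul_one, metaEstimator_const hs, hs.p_mem.1.2] using this

/-- A second meta-node has positive probability, which keeps the denominator `1 - p` of the
loop-free estimator positive. -/
theorem exists_metaNode_ne (hK : 2 ≤ K) (P : CliquePartition G κ) (v : {i // i ∈ noLoop G}) :
    ∃ m : MetaNode G κ, m ≠ .inr v := by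
  have : Nontrivial (Fin K) := Fin.nontrivial_iff_two_le.2 hK
  obtain ⟨k, hk⟩ := exists_ne v.1
  by_cases h : k ∈ noLoop G
  · exact ⟨.inr ⟨k, h⟩, fun h' => hk (congrArg Subtype.val (Sum.inr_injective h'))⟩
  · have hk' : G.Adj k k := by simpa [noLoop] using h
    obtain ⟨j, -⟩ := (P.cover k).1 hk'
    exact ⟨.inl j, by simp⟩

/-- The loss estimator is unbiased. -/
theorem sum_playProb_mul_roundEst (hK : 2 ≤ K) (hT : 0 < T) (hG : StronglyObservable G)
    {s : AlgState G κ} (hs : Valid P T η s) (loss : Fin K → ℝ) (v : Fin K) :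
    ∑ a, playProb s a * roundEst P loss s a v = loss v := by
  by_cases hv : v ∈ noLoop G
  · have hvv : ¬ G.Adj v v := by simpa [noLoop] using hv
    have hadj : ∀ i, i ≠ v → G.Adj i v := by
      intro i hi
      have h : inNbrs G v = {v}ᶜ := (hG v).2.resolve_left hvv
      have : i ∈ inNbrs G v := h ▸ hi
      exact this
    obtain ⟨m, hm⟩ := exists_metaNode_ne hK P ⟨v, hv⟩
    have hq : 0 < 1 - s.p (.inr ⟨v, hv⟩) := by
      linarith [metaDomain_add_le_one hs.p_mem hm, metaDomain_pos hT hs.p_mem m]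
    obtain ⟨x, hx⟩ : ∃ x, x = loss v / (1 - s.p (.inr ⟨v, hv⟩)) := ⟨_, rfl⟩
    have hest : ∀ a : Action G κ, roundEst P loss s a v
        = (fun i => x * (1 - if i = v then 1 else 0)) a.2 := by
      intro a
      rw [roundEst, armEstimator, dif_pos hv]
      by_cases h : a.2 = v
      · simp [h]
      · simp [h, Ne.symm h, feedback, hadj a.2 h, hx]
    -- Arm `v` can be pulled only through its own meta-node, since Hedge puts no mass outside its
    -- clique; so `v` is observed with probability exactly `1 - p v`.
    have hmeta : ∀ m : MetaNode G κ,
        s.p m * metaEstimator s (fun i => x * (1 - if i = v then 1 else 0)) m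
          = s.p m * x - if m = .inr ⟨v, hv⟩ then s.p m * x else 0 := by
      rintro (j | w)
      · have h0 : (s.hedge j).dist v = 0 :=
          (hs.hedge_mem j).2.2 v (not_mem_cell_of_mem_noLoop P hv j)
        have h1 : ∀ i, (s.hedge j).dist i * (x * (1 - if i = v then 1 else 0))
            = (s.hedge j).dist i * x := by
          intro i
          split_ifs with h
          · simp [h, h0]
          · simp
        simp only [metaEstimator, h1, ← Finset.sum_mul, (hs.hedge_mem j).1.2]
        simp
      · by_cases h : w = ⟨v, hv⟩
        · simp [metaEstimator, h]
        · simp [metaEstimator, h, Subtype.ext_iff.not.1 h]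
    rw [Finset.sum_congr rfl fun a _ => by rw [hest a],
      sum_playProb_mul s fun i => x * (1 - if i = v then 1 else 0),
      Finset.sum_congr rfl fun m _ => hmeta m]
    simp only [Finset.sum_sub_distrib, ← Finset.sum_mul, hs.p_mem.1.2,
      Finset.sum_ite_eq', Finset.mem_univ, if_true]
    rw [hx]
    field_simp
  · have hvv : G.Adj v v := by simpa [noLoop] using hv
    obtain ⟨j, hj⟩ := (P.cover v).1 hvv
    have hq := metaDomain_pos hT hs.p_mem (.inl j)
    rw [Fintype.sum_prod_type, Finset.sum_eq_single (.inl j)]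
    · have : ∀ i, playProb s (.inl j, i) * roundEst P loss s (.inl j, i) v
          = (s.hedge j).dist i * loss v := by
        intro i
        simp only [playProb, roundEst, armEstimator, dif_neg hv, if_pos hj]
        by_cases hi : i ∈ P.cell j
        · have hadj : G.Adj i v := by
            by_cases hiv : i = v
            · exact hiv ▸ hvv
            · exact P.clique j i hi v hj hiv
          simp only [feedback, if_pos hadj]
          field_simp
        · simp [(hs.hedge_mem j).2.2 i hi]
      simp only [this, ← Finset.sum_mul, (hs.hedge_mem j).1.2, one_mul]
    · rintro (j' | w) - hne
      · refine Finset.sum_eq_zero fun i _ => ?_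
        have : v ∉ P.cell j' := fun h => hne (by rw [mem_cell_unique P h hj])
        simp [roundEst, armEstimator, hv, this]
      · refine Finset.sum_eq_zero fun i _ => ?_
        simp [roundEst, armEstimator, hv]
    · simp

theorem sum_playProb_mul_sum_roundEst (hK : 2 ≤ K) (hT : 0 < T) (hG : StronglyObservable G)
    {s : AlgState G κ} (hs : Valid P T η s) (loss w : Fin K → ℝ) :
    ∑ a, playProb s a * ∑ v, w v * roundEst P loss s a v = ∑ v, w v * loss v := by
  simp only [Finset.mul_sum, mul_left_comm _ (w _) _]
  rw [Finset.sum_comm]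
  simp only [← Finset.mul_sum, sum_playProb_mul_roundEst hK hT hG hs]

theorem sum_playProb_mul_metaEstimator (hK : 2 ≤ K) (hT : 0 < T) (hG : StronglyObservable G)
    {s : AlgState G κ} (hs : Valid P T η s) (loss : Fin K → ℝ) (m : MetaNode G κ) :
    ∑ a, playProb s a * metaEstimator s (roundEst P loss s a) m = metaEstimator s loss m := by
  rcases m with j | v
  · exact sum_playProb_mul_sum_roundEst hK hT hG hs loss _
  · exact sum_playProb_mul_roundEst hK hT hG hs loss _

theorem sum_playProb_mul_sum_metaEstimator (hK : 2 ≤ K) (hT : 0 < T) (hG : StronglyObservable G)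
    {s : AlgState G κ} (hs : Valid P T η s) (loss : Fin K → ℝ) (w : MetaNode G κ → ℝ) :
    ∑ a, playProb s a * ∑ m, w m * metaEstimator s (roundEst P loss s a) m
      = ∑ m, w m * metaEstimator s loss m := by
  simp only [Finset.mul_sum, mul_left_comm _ (w _) _]
  rw [Finset.sum_comm]
  simp only [← Finset.mul_sum, sum_playProb_mul_metaEstimator hK hT hG hs]

theorem metaEstimator_mem {s : AlgState G κ} (hs : Valid P T η s) {loss : Fin K → ℝ}
    (hloss : ∀ i, loss i ∈ Set.Icc (0 : ℝ) 1) (m : MetaNode G κ) :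
    metaEstimator s loss m ∈ Set.Icc (0 : ℝ) 1 := by
  refine ⟨metaEstimator_nonneg hs (fun v => (hloss v).1) m, ?_⟩
  rcases m with j | v
  · rw [metaEstimator, ← (hs.hedge_mem j).1.2]
    exact Finset.sum_le_sum fun i _ => mul_le_of_le_one_right ((hs.hedge_mem j).1.1 i) (hloss i).2
  · exact (hloss _).2

/-! Sums along a path. -/

/-- The sum over the rounds of a path of a function of the round, the state and the outcome. -/
noncomputable def pathSum (P : CliquePartition G κ) (T : ℕ) (η c : ℝ) (ℓ : ℕ → Fin K → ℝ)
    (f : ℕ → AlgState G κ → Action G κ → ℝ) : (n : ℕ) → (Fin n → Action G κ) → ℝ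
  | 0, _ => 0
  | n + 1, h => pathSum P T η c ℓ f n (fun t => h t.castSucc)
      + f n (stateAfter P T η c ℓ n fun t => h t.castSucc) (h (Fin.last n))

variable {ℓ : ℕ → Fin K → ℝ}

theorem pathSum_add (f g : ℕ → AlgState G κ → Action G κ → ℝ) (n : ℕ) (h : Fin n → Action G κ) :
    pathSum P T η c ℓ (fun t s a => f t s a + g t s a) n h
      = pathSum P T η c ℓ f n h + pathSum P T η c ℓ g n h := by
  induction n with
  | zero => simp [pathSum]
  | succ n ih => simp only [pathSum, ih]; ring

theorem pathSum_mul (x : ℝ) (f : ℕ → AlgState G κ → Action G κ → ℝ) (n : ℕ)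
    (h : Fin n → Action G κ) :
    pathSum P T η c ℓ (fun t s a => x * f t s a) n h = x * pathSum P T η c ℓ f n h := by
  induction n with
  | zero => simp [pathSum]
  | succ n ih => simp only [pathSum, ih]; ring

theorem pathSum_const (g : ℕ → ℝ) (n : ℕ) (h : Fin n → Action G κ) :
    pathSum P T η c ℓ (fun t _ _ => g t) n h = ∑ t ∈ Finset.range n, g t := by
  induction n with
  | zero => simp [pathSum]
  | succ n ih => rw [Finset.sum_range_succ, pathSum, ih]

theorem sum_eq_pathSum (n : ℕ) (h : Fin n → Action G κ) :
    ∑ t : Fin n, ℓ t (h t).2 = pathSum P T η c ℓ (fun t _ a => ℓ t a.2) n h := by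
  induction n with
  | zero => simp [pathSum]
  | succ n ih =>
    rw [Fin.sum_univ_castSucc, pathSum, ← ih]
    simp

theorem stateAfter_valid (hT : 4 ≤ T) (hK : K ≤ T) (hη : 0 < η) (hη1 : η ≤ 1 / 1000) (hc : 4 ≤ c)
    (hne : (metaDomain G κ T).Nonempty) {n : ℕ}
    (hℓ : ∀ t < n, ∀ i, ℓ t i ∈ Set.Icc (0 : ℝ) 1) (h : Fin n → Action G κ) :
    Valid P T η (stateAfter P T η c ℓ n h) := by
  induction n with
  | zero => exact algInit_valid P (by omega) hK hη hne
  | succ n ih =>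
    exact algStep_valid hT hη hη1 hc (ih (fun t ht => hℓ t (by omega)) _)
      (hℓ n (Nat.lt_succ_self n))

theorem pathProb_nonneg (hT : 4 ≤ T) (hK : K ≤ T) (hη : 0 < η) (hη1 : η ≤ 1 / 1000) (hc : 4 ≤ c)
    (hne : (metaDomain G κ T).Nonempty) {n : ℕ}
    (hℓ : ∀ t < n, ∀ i, ℓ t i ∈ Set.Icc (0 : ℝ) 1) (h : Fin n → Action G κ) :
    0 ≤ pathProb P T η c ℓ n h := by
  induction n with
  | zero => simp [pathProb]
  | succ n ih =>
    exact mul_nonneg (ih (fun t ht => hℓ t (by omega)) _)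
      (playProb_nonneg (stateAfter_valid hT hK hη hη1 hc hne (fun t ht => hℓ t (by omega)) _) _)

theorem sum_path_succ (n : ℕ) (F : (Fin (n + 1) → Action G κ) → ℝ) :
    ∑ h, F h = ∑ h : Fin n → Action G κ, ∑ a, F (Fin.snoc (α := fun _ => Action G κ) h a) := by
  rw [← (Fin.snocEquiv fun _ => Action G κ).sum_comp, Fintype.sum_prod_type, Finset.sum_comm]
  rfl

/-- Tower property: condition on all rounds but the last. -/
theorem sum_pathProb_mul (n : ℕ) (F : (Fin (n + 1) → Action G κ) → ℝ) :
    ∑ h, pathProb P T η c ℓ (n + 1) h * F h = ∑ h, pathProb P T η c ℓ n h *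
      ∑ a, playProb (stateAfter P T η c ℓ n h) a
        * F (Fin.snoc (α := fun _ => Action G κ) h a) := by
  rw [sum_path_succ]
  refine Finset.sum_congr rfl fun h _ => ?_
  rw [Finset.mul_sum]
  refine Finset.sum_congr rfl fun a _ => ?_
  simp only [pathProb, Fin.snoc_castSucc, Fin.snoc_last]
  ring

theorem sum_pathProb (hT : 4 ≤ T) (hK : K ≤ T) (hη : 0 < η) (hη1 : η ≤ 1 / 1000) (hc : 4 ≤ c)
    (hne : (metaDomain G κ T).Nonempty) {n : ℕ}
    (hℓ : ∀ t < n, ∀ i, ℓ t i ∈ Set.Icc (0 : ℝ) 1) :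
    ∑ h, pathProb P T η c ℓ n h = 1 := by
  induction n with
  | zero => simp [pathProb]
  | succ n ih =>
    have hℓ' : ∀ t < n, ∀ i, ℓ t i ∈ Set.Icc (0 : ℝ) 1 := fun t ht => hℓ t (by omega)
    have := sum_pathProb_mul (P := P) (T := T) (η := η) (c := c) (ℓ := ℓ) n fun _ => 1
    simp only [mul_one, sum_playProb (stateAfter_valid (P := P) hT hK hη hη1 hc hne hℓ' _)] at this
    rw [this, ih hℓ']

/-- A path sum of functions with nonnegative conditional expectation has nonnegative
expectation. -/
theorem sum_pathProb_mul_pathSum_nonneg (hT : 4 ≤ T) (hK : K ≤ T) (hη : 0 < η)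
    (hη1 : η ≤ 1 / 1000) (hc : 4 ≤ c) (hne : (metaDomain G κ T).Nonempty) {n : ℕ}
    (hℓ : ∀ t < n, ∀ i, ℓ t i ∈ Set.Icc (0 : ℝ) 1) {f : ℕ → AlgState G κ → Action G κ → ℝ}
    (hf : ∀ t < n, ∀ s, Valid P T η s → 0 ≤ ∑ a, playProb s a * f t s a) :
    0 ≤ ∑ h, pathProb P T η c ℓ n h * pathSum P T η c ℓ f n h := by
  induction n with
  | zero => simp [pathSum]
  | succ n ih =>
    have hℓ' : ∀ t < n, ∀ i, ℓ t i ∈ Set.Icc (0 : ℝ) 1 := fun t ht => hℓ t (by omega)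
    rw [sum_pathProb_mul]
    refine (ih hℓ' fun t ht => hf t (by omega)).trans (Finset.sum_le_sum fun h _ => ?_)
    have hv := stateAfter_valid (P := P) hT hK hη hη1 hc hne hℓ' h
    refine mul_le_mul_of_nonneg_left ?_ (pathProb_nonneg hT hK hη hη1 hc hne hℓ' h)
    simp only [pathSum, Fin.snoc_castSucc, Fin.snoc_last, mul_add, Finset.sum_add_distrib,
      ← Finset.sum_mul, sum_playProb hv, one_mul]
    linarith [hf n (Nat.lt_succ_self n) _ hv]

end Expectation

/-! ### Path-wise regret bounds and the passage to expectations. -/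

section Paths

variable {K κ T : ℕ} {G : Digraph (Fin K)} {P : CliquePartition G κ} {η c : ℝ}
  {ℓ : ℕ → Fin K → ℝ}

/-- The linearized regret of the meta-algorithm in one round, with a discount `y` on its own
loss. -/
noncomputable def metaGap (P : CliquePartition G κ) (ℓ : ℕ → Fin K → ℝ) (y : ℝ)
    (u : MetaNode G κ → ℝ) (t : ℕ) (s : AlgState G κ) (a : Action G κ) : ℝ :=
  (1 - y) * ∑ j, s.p j * metaEstimator s (roundEst P (ℓ t) s a) j
    - ∑ j, u j * metaEstimator s (roundEst P (ℓ t) s a) j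

/-- The linearized regret of a Hedge instance in one round. -/
noncomputable def hedgeGap (P : CliquePartition G κ) (ℓ : ℕ → Fin K → ℝ) (k : Fin κ)
    (w : Fin K → ℝ) (t : ℕ) (s : AlgState G κ) (a : Action G κ) : ℝ :=
  ∑ i, ((s.hedge k).dist i - w i) * roundEst P (ℓ t) s a i

/-- The estimated loss of a fixed distribution over the arms in one round. -/
noncomputable def estLoss (P : CliquePartition G κ) (ℓ : ℕ → Fin K → ℝ)
    (w : Fin K → ℝ) (t : ℕ) (s : AlgState G κ) (a : Action G κ) : ℝ :=
  ∑ i, w i * roundEst P (ℓ t) s a i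

/-- The hypotheses on the parameters under which the path-wise bounds hold. -/
structure Params (G : Digraph (Fin K)) (κ T : ℕ) (η c : ℝ) : Prop where
  four_le : 4 ≤ T
  le_horizon : K ≤ T
  pos : 0 < η
  le : η ≤ 1 / 1000
  four_le_c : 4 ≤ c
  nonempty : (metaDomain G κ T).Nonempty

theorem Params.valid (hp : Params G κ T η c) {n : ℕ}
    (hℓ : ∀ t < n, ∀ i, ℓ t i ∈ Set.Icc (0 : ℝ) 1) (h : Fin n → Action G κ) :
    Valid P T η (stateAfter P T η c ℓ n h) :=
  stateAfter_valid hp.four_le hp.le_horizon hp.pos hp.le hp.four_le_c hp.nonempty hℓ h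

/-- The divergences telescope despite the changing rates, because raising a rate only lowers the
divergence. -/
theorem pathSum_metaGap_add_metaDiv_le (hp : Params G κ T η c) {u : MetaNode G κ → ℝ}
    (hu : u ∈ metaDomain G κ T) {n : ℕ}
    (hℓ : ∀ t < n, ∀ i, ℓ t i ∈ Set.Icc (0 : ℝ) 1) (h : Fin n → Action G κ) :
    pathSum P T η c ℓ (metaGap P ℓ (48 * η) u) n h
        + metaDiv (stateAfter P T η c ℓ n h).rate η c u (stateAfter P T η c ℓ n h).p
      ≤ metaDiv (fun _ => η) η c u (algInit P T η c).p := by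
  induction n with
  | zero => rw [pathSum, zero_add]; rfl
  | succ n ih =>
    have hℓ' : ∀ t < n, ∀ i, ℓ t i ∈ Set.Icc (0 : ℝ) 1 := fun t ht => hℓ t (by omega)
    have hv : Valid P T η (stateAfter P T η c ℓ n fun t => h t.castSucc) := hp.valid hℓ' _
    have h1 := (algStep_meta (a := h (Fin.last n)) hp.four_le hp.pos hp.le hp.four_le_c hv
      (hℓ n (Nat.lt_succ_self n)) hu).2
    have h2 := (algStep_gain (a := h (Fin.last n)) hp.four_le hp.pos hp.le hp.four_le_c hv
      (hℓ n (Nat.lt_succ_self n)) hu).1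
    have h3 := ih hℓ' fun t => h t.castSucc
    simp only [pathSum, stateAfter, metaGap] at h3 ⊢
    linarith

theorem pathSum_metaGap_le (hp : Params G κ T η c) {u : MetaNode G κ → ℝ}
    (hu : u ∈ metaDomain G κ T) {n : ℕ}
    (hℓ : ∀ t < n, ∀ i, ℓ t i ∈ Set.Icc (0 : ℝ) 1) (h : Fin n → Action G κ) :
    pathSum P T η c ℓ (metaGap P ℓ (48 * η) u) n h
      ≤ metaDiv (fun _ => η) η c u (algInit P T η c).p := by
  have hv : Valid P T η (stateAfter P T η c ℓ n h) := hp.valid hℓ h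
  have := metaDiv_nonneg (c := c) (by linarith [hp.four_le])
    (fun j => hp.pos.trans_le (hv.le_rate j)) hp.pos (by linarith [hp.four_le_c]) hu hv.p_mem
  linarith [pathSum_metaGap_add_metaDiv_le (P := P) hp hu hℓ h]

theorem pathSum_metaGap_add_thr_le (hp : Params G κ T η c) {u : MetaNode G κ → ℝ}
    (hu : u ∈ metaDomain G κ T) {k : Fin κ} (hk : 1 / 2 ≤ u (.inl k)) {n : ℕ}
    (hℓ : ∀ t < n, ∀ i, ℓ t i ∈ Set.Icc (0 : ℝ) 1) (h : Fin n → Action G κ) :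
    pathSum P T η c ℓ (metaGap P ℓ (48 * η) u) n h
        + ((stateAfter P T η c ℓ n h).thr k / (64 * (η * Real.log T)) - κ / η)
      ≤ metaDiv (fun _ => η) η c u (algInit P T η c).p := by
  -- The truncation at zero makes the induction start: with threshold `2κ` the subtracted `κ / η`
  -- dominates. It also matches the potential of `algStep_gain`.
  have key : ∀ (n : ℕ) (_ : ∀ t < n, ∀ i, ℓ t i ∈ Set.Icc (0 : ℝ) 1) (h : Fin n → Action G κ),
      pathSum P T η c ℓ (metaGap P ℓ (48 * η) u) n h
        + metaDiv (stateAfter P T η c ℓ n h).rate η c u (stateAfter P T η c ℓ n h).p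
        + max 0 ((stateAfter P T η c ℓ n h).thr k / (64 * (η * Real.log T)) - κ / η)
      ≤ metaDiv (fun _ => η) η c u (algInit P T η c).p := by
    intro n
    induction n with
    | zero =>
      intro _ h
      have hl := one_le_log hp.four_le
      have h1 : 2 * (κ : ℝ) / (64 * (η * Real.log T)) - κ / η ≤ 0 := by
        rw [sub_nonpos, div_le_div_iff₀ (mul_pos (by norm_num) (mul_pos hp.pos (by linarith)))
          hp.pos]
        nlinarith [mul_pos hp.pos (lt_of_lt_of_le one_pos (kappa_pos k))]
      rw [pathSum, zero_add]
      change metaDiv (fun _ => η) η c u (algInit P T η c).p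
        + max 0 (2 * (κ : ℝ) / (64 * (η * Real.log T)) - κ / η) ≤ _
      rw [max_eq_left h1, add_zero]
    | succ n ih =>
      intro hℓ h
      have hℓ' : ∀ t < n, ∀ i, ℓ t i ∈ Set.Icc (0 : ℝ) 1 := fun t ht => hℓ t (by omega)
      have hv : Valid P T η (stateAfter P T η c ℓ n fun t => h t.castSucc) := hp.valid hℓ' _
      have h1 := (algStep_meta (a := h (Fin.last n)) hp.four_le hp.pos hp.le hp.four_le_c hv
        (hℓ n (Nat.lt_succ_self n)) hu).2
      have h2 := (algStep_gain (a := h (Fin.last n)) hp.four_le hp.pos hp.le hp.four_le_c hv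
        (hℓ n (Nat.lt_succ_self n)) hu).2 k hk
      have h3 := ih hℓ' fun t => h t.castSucc
      simp only [pathSum, stateAfter, metaGap] at h3 ⊢
      linarith
  have hv : Valid P T η (stateAfter P T η c ℓ n h) := hp.valid hℓ h
  have h1 := metaDiv_nonneg (c := c) (by linarith [hp.four_le])
    (fun j => hp.pos.trans_le (hv.le_rate j)) hp.pos (by linarith [hp.four_le_c]) hu hv.p_mem
  have h2 := le_max_right 0 ((stateAfter P T η c ℓ n h).thr k / (64 * (η * Real.log T)) - κ / η)
  linarith [key n hℓ h]

theorem pathSum_hedgeGap_le (hp : Params G κ T η c) {k : Fin κ} {w : Fin K → ℝ}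
    (hw : w ∈ hedgeDomain T (P.cell k)) {n : ℕ}
    (hℓ : ∀ t < n, ∀ i, ℓ t i ∈ Set.Icc (0 : ℝ) 1) (h : Fin n → Action G κ) :
    pathSum P T η c ℓ (hedgeGap P ℓ k w) n h
      ≤ (Real.log ((K : ℝ) * T) + 2) * √(1 + ((stateAfter P T η c ℓ n h).hedge k).acc) := by
  have hT0 : 0 < T := by linarith [hp.four_le]
  have key : ∀ (n : ℕ) (_ : ∀ t < n, ∀ i, ℓ t i ∈ Set.Icc (0 : ℝ) 1) (h : Fin n → Action G κ),
      pathSum P T η c ℓ (hedgeGap P ℓ k w) n h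
        + √(1 + ((stateAfter P T η c ℓ n h).hedge k).acc)
          * relEntropy w ((stateAfter P T η c ℓ n h).hedge k).dist
      ≤ Real.log ((K : ℝ) * T) + (√(1 + ((stateAfter P T η c ℓ n h).hedge k).acc) - 1)
          * (Real.log ((K : ℝ) * T) + 2) := by
    intro n
    induction n with
    | zero =>
      intro _ h
      have := relEntropy_le hT0 hw (hedgeInit_mem hT0 (P.nonempty k))
      simpa [pathSum, stateAfter, algInit, hedgeInit] using this
    | succ n ih =>
      intro hℓ h
      have hℓ' : ∀ t < n, ∀ i, ℓ t i ∈ Set.Icc (0 : ℝ) 1 := fun t ht => hℓ t (by omega)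
      have hv : Valid P T η (stateAfter P T η c ℓ n fun t => h t.castSucc) := hp.valid hℓ' _
      have h1 := (hedgeStep_dist hT0 (hv.hedge_mem k) (hv.acc_nonneg k)
        (roundEst_nonneg (a := h (Fin.last n)) hv (hℓ n (Nat.lt_succ_self n))) hw
        (relEntropy_le hT0 hw (hv.hedge_mem k))).2.2
      have h3 := ih hℓ' fun t => h t.castSucc
      simp only [pathSum, stateAfter, hedgeGap] at h3 ⊢
      change _ + √(1 + (hedgeStep T (P.cell k) _ (roundEst P (ℓ n) _ _)).acc)
        * relEntropy w (hedgeStep T (P.cell k) _ (roundEst P (ℓ n) _ _)).dist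
        ≤ _ + (√(1 + (hedgeStep T (P.cell k) _ (roundEst P (ℓ n) _ _)).acc) - 1) * _
      linarith
  have hv : Valid P T η (stateAfter P T η c ℓ n h) := hp.valid hℓ h
  have h1 := mul_nonneg (Real.sqrt_nonneg (1 + ((stateAfter P T η c ℓ n h).hedge k).acc))
    (relEntropy_nonneg hT0 hw (hv.hedge_mem k))
  linarith [key n hℓ h]

theorem pathSum_nonneg (hp : Params G κ T η c) {f : ℕ → AlgState G κ → Action G κ → ℝ} {n : ℕ}
    (hℓ : ∀ t < n, ∀ i, ℓ t i ∈ Set.Icc (0 : ℝ) 1)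
    (hf : ∀ t < n, ∀ s, Valid P T η s → ∀ a, 0 ≤ f t s a) (h : Fin n → Action G κ) :
    0 ≤ pathSum P T η c ℓ f n h := by
  induction n with
  | zero => exact le_rfl
  | succ n ih =>
    have hℓ' : ∀ t < n, ∀ i, ℓ t i ∈ Set.Icc (0 : ℝ) 1 := fun t ht => hℓ t (by omega)
    exact add_nonneg (ih hℓ' (fun t ht => hf t (by omega)) _)
      (hf n (Nat.lt_succ_self n) _ (hp.valid hℓ' _) _)

/-- The estimates in the clique are at most `1 / p`, so a round adds at most `1 / p` times the
clique's estimated loss. From the second round on `1 / p` is below the current threshold, and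
thresholds only grow. -/
theorem acc_le (hp : Params G κ T η c) (k : Fin κ) {n : ℕ}
    (hℓ : ∀ t < n, ∀ i, ℓ t i ∈ Set.Icc (0 : ℝ) 1) (h : Fin n → Action G κ) :
    ((stateAfter P T η c ℓ n h).hedge k).acc ≤ (1 / (algInit P T η c).p (.inl k)) ^ 2
      + (stateAfter P T η c ℓ n h).thr k * pathSum P T η c ℓ
        (fun t s a => metaEstimator s (roundEst P (ℓ t) s a) (.inl k)) n h := by
  have hT0 : 0 < T := by linarith [hp.four_le]
  induction n with
  | zero =>
    rw [pathSum, mul_zero, add_zero]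
    exact sq_nonneg _
  | succ n ih =>
    have hℓ' : ∀ t < n, ∀ i, ℓ t i ∈ Set.Icc (0 : ℝ) 1 := fun t ht => hℓ t (by omega)
    have hln := hℓ n (Nat.lt_succ_self n)
    have hV : 0 ≤ pathSum P T η c ℓ (fun t s a => metaEstimator s (roundEst P (ℓ t) s a) (.inl k))
        n (fun t => h t.castSucc) :=
      pathSum_nonneg hp hℓ' (fun t ht s hs a => metaEstimator_nonneg hs
        (roundEst_nonneg hs (hℓ' t ht)) _) _
    have ih' := ih hℓ' fun t => h t.castSucc
    have hv : Valid P T η (stateAfter P T η c ℓ n fun t => h t.castSucc) := hp.valid hℓ' _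
    set s := stateAfter P T η c ℓ n fun t => h t.castSucc with hs
    set a := h (Fin.last n)
    set V := pathSum P T η c ℓ (fun t s a => metaEstimator s (roundEst P (ℓ t) s a) (.inl k))
        n (fun t => h t.castSucc)
    have hthr0 : 0 ≤ s.thr k := by linarith [hv.le_thr k, kappa_pos k]
    have hthr : s.thr k ≤ (algStep P T η c (ℓ n) s a).thr k := (algStep_thr hthr0).1
    have hp0 := metaDomain_pos hT0 hv.p_mem (.inl k)
    set e := metaEstimator s (roundEst P (ℓ n) s a) (.inl k) with he
    have he0 : 0 ≤ e := metaEstimator_nonneg hv (roundEst_nonneg hv hln) _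
    have hx : ∑ i, (s.hedge k).dist i * roundEst P (ℓ n) s a i ^ 2
        ≤ 1 / s.p (.inl k) * e := by
      rw [he, metaEstimator, Finset.mul_sum]
      refine Finset.sum_le_sum fun i _ => ?_
      by_cases hi : i ∈ P.cell k
      · have h1 := roundEst_cell_le (a := a) hT0 hv hln hi
        have h2 : roundEst P (ℓ n) s a i ≤ 1 / s.p (.inl k) := by
          rw [le_div_iff₀ hp0]; linarith
        have h3 := mul_nonneg ((hv.hedge_mem k).1.1 i) (roundEst_nonneg (a := a) hv hln i)
        nlinarith
      · simp [(hv.hedge_mem k).2.2 i hi]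
    change (s.hedge k).acc + ∑ i, (s.hedge k).dist i * roundEst P (ℓ n) s a i ^ 2
      ≤ _ + (algStep P T η c (ℓ n) s a).thr k * (V + e)
    have h4 : s.thr k * V ≤ (algStep P T η c (ℓ n) s a).thr k * V :=
      mul_le_mul_of_nonneg_right hthr hV
    -- In the first round the threshold need not dominate `1 / p`; the bound `p * e ≤ 1` gives the
    -- separate term `(1 / p)²`.
    rcases n with _ | n
    · have h1 : e ≤ 1 / s.p (.inl k) := by
        rw [le_div_iff₀ hp0]
        linarith [metaEstimator_roundEst_inl_le (a := a) hT0 hv hln k]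
      have h2 : 1 / s.p (.inl k) * e ≤ (1 / s.p (.inl k)) ^ 2 := by
        rw [sq]
        exact mul_le_mul_of_nonneg_left h1 (by positivity)
      have h3 : (s.hedge k).acc = 0 := rfl
      have h5 : 0 ≤ (algStep P T η c (ℓ 0) s a).thr k * (V + e) :=
        mul_nonneg (hthr0.trans hthr) (add_nonneg hV he0)
      change _ ≤ (1 / s.p (.inl k)) ^ 2 + _
      linarith
    · have hv' : Valid P T η (stateAfter P T η c ℓ n fun t => h t.castSucc.castSucc) :=
        hp.valid (fun t ht => hℓ t (by omega)) _
      have h1 : 1 / s.p (.inl k) ≤ s.thr k :=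
        (algStep_thr (by linarith [hv'.le_thr k, kappa_pos k])).2
      have h2 := mul_le_mul_of_nonneg_right (h1.trans hthr) he0
      linarith

/-- The path-wise bound for a comparator inside a clique. -/
theorem pathSum_gap_le (hp : Params G κ T η c) {k : Fin κ} {w : Fin K → ℝ}
    (hw : w ∈ hedgeDomain T (P.cell k)) {u : MetaNode G κ → ℝ}
    (hu : u ∈ metaDomain G κ T) (hk : 1 / 2 ≤ u (.inl k))
    (hL : 2 ≤ Real.log ((K : ℝ) * T))
    (hηL : η * Real.log T * Real.log ((K : ℝ) * T) ^ 2 ≤ 1 / 1000) {n : ℕ}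
    (hℓ : ∀ t < n, ∀ i, ℓ t i ∈ Set.Icc (0 : ℝ) 1) (h : Fin n → Action G κ) :
    pathSum P T η c ℓ (metaGap P ℓ (48 * η) u) n h + pathSum P T η c ℓ (hedgeGap P ℓ k w) n h
        - 200 * (η * Real.log T * Real.log ((K : ℝ) * T) ^ 2) * pathSum P T η c ℓ (estLoss P ℓ w) n h
      ≤ metaDiv (fun _ => η) η c u (algInit P T η c).p + κ / η
        + 2 * Real.log ((K : ℝ) * T) * (1 + 1 / (algInit P T η c).p (.inl k)) := by
  have hT0 : 0 < T := by linarith [hp.four_le]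
  have hl := one_le_log hp.four_le
  have hN : 0 < η * Real.log T := mul_pos hp.pos (by linarith)
  have hmeta := pathSum_metaGap_add_thr_le (P := P) hp hu hk hℓ h
  have hhedge := pathSum_hedgeGap_le (P := P) hp hw hℓ h
  have hacc := acc_le (P := P) hp k hℓ h
  have hU : 0 ≤ pathSum P T η c ℓ (estLoss P ℓ w) n h :=
    pathSum_nonneg hp hℓ (fun t ht s hs a => Finset.sum_nonneg fun i _ =>
      mul_nonneg (hw.1.1 i) (roundEst_nonneg hs (hℓ t ht) i)) h
  -- The clique's estimated loss is its regret plus the comparator's loss, which makes the Hedge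
  -- bound self-referential.
  have hRU : pathSum P T η c ℓ
      (fun t s a => metaEstimator s (roundEst P (ℓ t) s a) (.inl k)) n h
      = pathSum P T η c ℓ (hedgeGap P ℓ k w) n h + pathSum P T η c ℓ (estLoss P ℓ w) n h := by
    rw [← pathSum_add]
    congr 1
    funext t s a
    simp only [metaEstimator, hedgeGap, estLoss, ← Finset.sum_add_distrib]
    exact Finset.sum_congr rfl fun i _ => by ring
  have hv : Valid P T η (stateAfter P T η c ℓ n h) := hp.valid hℓ h
  have hv0 : Valid P T η (algInit P T η c) :=
    algInit_valid P hT0 hp.le_horizon hp.pos hp.nonempty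
  have hB : 0 < 1 / (algInit P T η c).p (.inl k) :=
    one_div_pos.2 (metaDomain_pos hT0 hv0.p_mem _)
  have hρ : 0 ≤ (stateAfter P T η c ℓ n h).thr k := by linarith [hv.le_thr k, kappa_pos k]
  rw [hRU] at hacc
  set R := pathSum P T η c ℓ (hedgeGap P ℓ k w) n h
  set U := pathSum P T η c ℓ (estLoss P ℓ w) n h
  set ρ := (stateAfter P T η c ℓ n h).thr k
  set B := 1 / (algInit P T η c).p (.inl k)
  set Λ := Real.log ((K : ℝ) * T)
  set N := η * Real.log T
  -- The factor `Λ + 2` is at most `2 * Λ`.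
  have hR : R ≤ 2 * Λ * √(1 + (B ^ 2 + ρ * (R + U))) := by
    refine hhedge.trans (mul_le_mul (by linarith) (Real.sqrt_le_sqrt (by linarith))
      (Real.sqrt_nonneg _) (by linarith))
  have h1 := le_of_sq_le (by linarith) hB.le hU hρ hN hR
  -- The cap on `η` gives `N Λ² ≤ 1/1000`. The positive multiples of `ρ / N` then add up to `4/1000
  -- + 1/200`, below the available `1/64`.
  have h2 : (2 * Λ) ^ 2 * ρ ≤ 4 / 1000 * (ρ / N) := by
    have : (2 * Λ) ^ 2 * ρ = 4 * (N * Λ ^ 2) * (ρ / N) := by field_simp; ring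
    rw [this]
    have := mul_le_mul_of_nonneg_right hηL (div_nonneg hρ hN.le)
    linarith
  have h3 : ρ / (200 * N) = 1 / 200 * (ρ / N) := by field_simp
  have h4 : ρ / (64 * N) = 1 / 64 * (ρ / N) := by field_simp
  have h5 : 0 ≤ ρ / N := div_nonneg hρ hN.le
  have h6 : 50 * N * (2 * Λ) ^ 2 * U = 200 * (N * Λ ^ 2) * U := by ring
  linarith

/-- The deterministic bound `C` holds on all paths, so only the conditional mean of `X` in a single
round has to be compared with the true losses. Here `y` is the discount on the learner's own loss,
`x` the surcharge on the best arm's loss and `D` the total cost of shrinking the comparators. -/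
theorem regret_le_of_pathSum_le (hp : Params G κ T η c)
    (hℓ : ∀ t < T, ∀ i, ℓ t i ∈ Set.Icc (0 : ℝ) 1) {istar : Fin K} {x y C D : ℝ}
    {X : ℕ → AlgState G κ → Action G κ → ℝ}
    (hX : ∀ h, pathSum P T η c ℓ X T h ≤ C)
    (hE : ∀ t < T, ∀ s, Valid P T η s → (1 - y) * ∑ j, s.p j * metaEstimator s (ℓ t) j
      ≤ ∑ a, playProb s a * X t s a + (1 + x) * ℓ t istar + D / T) :
    (1 - y) * regret P T η c ℓ istar ≤ C + (x + y) * totalLoss T ℓ istar + D := by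
  have hT0 : (0 : ℝ) < T := by exact_mod_cast (by linarith [hp.four_le] : 0 < T)
  have hone := sum_pathProb (P := P) hp.four_le hp.le_horizon hp.pos hp.le hp.four_le_c
    hp.nonempty hℓ
  have h0 := sum_pathProb_mul_pathSum_nonneg (P := P) hp.four_le hp.le_horizon hp.pos hp.le
    hp.four_le_c hp.nonempty hℓ
    (f := fun t s a => (X t s a + -(1 - y) * ℓ t a.2) + ((1 + x) * ℓ t istar + D / T)) (by
      intro t ht s hs
      simp only [mul_add, Finset.sum_add_distrib, ← Finset.sum_mul, sum_playProb hs, one_mul,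
        mul_left_comm _ (-(1 - y)) _, ← Finset.mul_sum, sum_playProb_mul s (ℓ t)]
      linarith [hE t ht s hs])
  have hpath : ∀ h, pathSum P T η c ℓ (fun t s a =>
      (X t s a + -(1 - y) * ℓ t a.2) + ((1 + x) * ℓ t istar + D / T)) T h
      ≤ C + (1 + x) * totalLoss T ℓ istar + D + -(1 - y) * ∑ t : Fin T, ℓ t (h t).2 := by
    intro h
    rw [pathSum_add, pathSum_add, pathSum_mul, pathSum_const, ← sum_eq_pathSum,
      Finset.sum_add_distrib, ← Finset.mul_sum, Finset.sum_const, Finset.card_range,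
      nsmul_eq_mul, mul_div_cancel₀ _ hT0.ne', totalLoss]
    linarith [hX h]
  have h1 := h0.trans (Finset.sum_le_sum fun h _ => mul_le_mul_of_nonneg_left (hpath h)
    (pathProb_nonneg hp.four_le hp.le_horizon hp.pos hp.le hp.four_le_c hp.nonempty hℓ h))
  simp only [mul_add, Finset.sum_add_distrib, ← Finset.sum_mul, hone, one_mul,
    mul_left_comm _ (-(1 - y)) _, ← Finset.mul_sum] at h1
  rw [regret]
  simp only [mul_sub, Finset.sum_sub_distrib, ← Finset.sum_mul, hone, one_mul]
  linarith

end Paths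

/-! ### Regret bounds and tuning of the learning rate. -/

section Final

variable {K κ T : ℕ} {G : Digraph (Fin K)} {P : CliquePartition G κ} {η c : ℝ}
  {ℓ : ℕ → Fin K → ℝ}

/-- The meta gap and the Hedge gap are added, so that the clique's mean loss cancels; the estimated
comparator loss is subtracted with weight `x` and returns in expectation as `x * Lstar`. Shrinking
the comparators costs at most `β / T` and `(1 + x) / T` per round. -/
theorem regret_le_of_mem_cell (hp : Params G κ T η c) (hK : 2 ≤ K) (hKT : 2 * K ≤ T)
    (hG : StronglyObservable G) (hL : 2 ≤ Real.log ((K : ℝ) * T))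
    (hηL : η * Real.log T * Real.log ((K : ℝ) * T) ^ 2 ≤ 1 / 1000)
    (hcη : c * η ≤ 1) (hℓ : ∀ t < T, ∀ i, ℓ t i ∈ Set.Icc (0 : ℝ) 1) {istar : Fin K} {k : Fin κ}
    (hk : istar ∈ P.cell k) :
    (1 - 48 * η) * regret P T η c ℓ istar ≤
      ((κ * Real.log T + Real.log K + 1) / η + c * (noLoop G).card * Real.log T + κ / η
        + 2 * Real.log ((K : ℝ) * T) * (1 + beta G κ * (3 * beta G κ + Real.log K)))
      + (200 * (η * Real.log T * Real.log ((K : ℝ) * T) ^ 2) + 48 * η) * totalLoss T ℓ istar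
      + (beta G κ + (1 + 200 * (η * Real.log T * Real.log ((K : ℝ) * T) ^ 2))) := by
  have hT0 : 0 < T := by linarith [hp.four_le]
  have hβ := beta_le P
  have hl := one_le_log hp.four_le
  have hc0 : 0 ≤ c := by linarith [hp.four_le_c]
  set x := 200 * (η * Real.log T * Real.log ((K : ℝ) * T) ^ 2) with hx
  have hx0 : 0 ≤ x := by
    have := hp.pos
    positivity
  have hu := metaComparator_mem (T := T) hT0 (by omega) (.inl k : MetaNode G κ)
  have hw : hedgeComparator T (P.cell k) istar ∈ hedgeDomain T (P.cell k) :=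
    hedgeComparator_mem hT0 hk
  refine regret_le_of_pathSum_le (X := fun t s a =>
    (metaGap P ℓ (48 * η) (metaComparator T (.inl k)) t s a
      + hedgeGap P ℓ k (hedgeComparator T (P.cell k) istar) t s a)
      + -x * estLoss P ℓ (hedgeComparator T (P.cell k) istar) t s a) hp hℓ (fun h => ?_)
      fun t ht s hs => ?_
  · rw [pathSum_add, pathSum_add, pathSum_mul]
    have h1 := pathSum_gap_le (P := P) hp hw hu (half_le_metaComparator hT0 (by omega) _)
      hL hηL hℓ h
    have h2 := metaDiv_algInit_le P hT0 (by omega) hp.pos hc0 hu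
    have h3 := one_div_algInit_le P hT0 (by omega) (by omega) hp.pos hc0 hcη k
    have h4 := mul_le_mul_of_nonneg_left (add_le_add (le_refl 1) h3)
      (by linarith : 0 ≤ 2 * Real.log ((K : ℝ) * T))
    linarith
  · have e1 : ∑ a, playProb s a * metaGap P ℓ (48 * η) (metaComparator T (.inl k)) t s a
        = (1 - 48 * η) * ∑ j, s.p j * metaEstimator s (ℓ t) j
          - ∑ j, metaComparator T (.inl k) j * metaEstimator s (ℓ t) j := by
      simp only [metaGap, mul_sub, mul_left_comm _ (1 - 48 * η) _, Finset.sum_sub_distrib,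
        ← Finset.mul_sum, sum_playProb_mul_sum_metaEstimator hK hT0 hG hs]
    have e2 : ∑ a, playProb s a * hedgeGap P ℓ k (hedgeComparator T (P.cell k) istar) t s a
        = metaEstimator s (ℓ t) (.inl k)
          - ∑ v, hedgeComparator T (P.cell k) istar v * ℓ t v := by
      simp only [hedgeGap, sum_playProb_mul_sum_roundEst hK hT0 hG hs, metaEstimator, sub_mul, mul_sub,
        Finset.sum_sub_distrib]
    have e3 : ∑ a, playProb s a * (-x * estLoss P ℓ (hedgeComparator T (P.cell k) istar) t s a)
        = -x * ∑ v, hedgeComparator T (P.cell k) istar v * ℓ t v := by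
      simp only [estLoss, mul_left_comm _ (-x) _, ← Finset.mul_sum,
        sum_playProb_mul_sum_roundEst hK hT0 hG hs]
    have h1 := sum_metaComparator_le (T := T) hT0 (.inl k) (metaEstimator_mem hs (hℓ t ht))
    have h2 := mul_le_mul_of_nonneg_left (sum_hedgeComparator_le (T := T) hT0 hk (hℓ t ht))
      (by linarith : 0 ≤ 1 + x)
    have e4 : (beta G κ + (1 + x)) / (T : ℝ) = beta G κ / T + (1 + x) * (1 / T) := by ring
    simp only [mul_add, Finset.sum_add_distrib]
    rw [e1, e2, e3, e4]
    linarith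

/-- No Hedge instance is involved, so the gain from increasing rates is not needed. -/
theorem regret_le_of_mem_noLoop (hp : Params G κ T η c) (hK : 2 ≤ K) (hKT : 2 * K ≤ T)
    (hG : StronglyObservable G) (hℓ : ∀ t < T, ∀ i, ℓ t i ∈ Set.Icc (0 : ℝ) 1) {istar : Fin K}
    (hi : istar ∈ noLoop G) :
    (1 - 48 * η) * regret P T η c ℓ istar ≤
      ((κ * Real.log T + Real.log K + 1) / η + c * (noLoop G).card * Real.log T)
      + (0 + 48 * η) * totalLoss T ℓ istar + beta G κ := by
  have hT0 : 0 < T := by linarith [hp.four_le]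
  have hβ := beta_le P
  have hc0 : 0 ≤ c := by linarith [hp.four_le_c]
  have hu := metaComparator_mem (T := T) hT0 (by omega) (.inr ⟨istar, hi⟩ : MetaNode G κ)
  refine regret_le_of_pathSum_le (X := metaGap P ℓ (48 * η) (metaComparator T (.inr ⟨istar, hi⟩)))
    hp hℓ (fun h => ?_) fun t ht s hs => ?_
  · exact (pathSum_metaGap_le hp hu hℓ h).trans (metaDiv_algInit_le P hT0 (by omega) hp.pos hc0 hu)
  · have e1 : ∑ a, playProb s a * metaGap P ℓ (48 * η) (metaComparator T (.inr ⟨istar, hi⟩)) t s a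
        = (1 - 48 * η) * ∑ j, s.p j * metaEstimator s (ℓ t) j
          - ∑ j, metaComparator T (.inr ⟨istar, hi⟩) j * metaEstimator s (ℓ t) j := by
      simp only [metaGap, mul_sub, mul_left_comm _ (1 - 48 * η) _, Finset.sum_sub_distrib,
        ← Finset.mul_sum, sum_playProb_mul_sum_metaEstimator hK hT0 hG hs]
    have h1 := sum_metaComparator_le (T := T) hT0 (.inr ⟨istar, hi⟩)
      (metaEstimator_mem hs (hℓ t ht))
    have e2 : metaEstimator s (ℓ t) (.inr ⟨istar, hi⟩) = ℓ t istar := rfl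
    rw [e1]
    linarith

theorem two_le_log_mul {K T : ℕ} (hK : 2 ≤ K) (hT : 4 ≤ T) : 2 ≤ Real.log ((K : ℝ) * T) := by
  have h1 : Real.log ((2 : ℝ) ^ 3) ≤ Real.log ((K : ℝ) * T) := by
    refine Real.log_le_log (by norm_num) ?_
    have h2 : (2 : ℝ) ≤ K := by exact_mod_cast hK
    have h3 : (4 : ℝ) ≤ T := by exact_mod_cast hT
    nlinarith
  rw [Real.log_pow] at h1
  push_cast at h1
  linarith [Real.log_two_gt_d9]

theorem one_le_beta (hK : 2 ≤ K) (P : CliquePartition G κ) : (1 : ℝ) ≤ beta G κ := by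
  have : 0 < beta G κ := by
    by_cases h : (⟨0, by omega⟩ : Fin K) ∈ noLoop G
    · exact (Finset.card_pos.2 ⟨_, h⟩).trans_le (Nat.le_add_left _ _)
    · have hk' : G.Adj (⟨0, by omega⟩ : Fin K) ⟨0, by omega⟩ := by simpa [noLoop] using h
      obtain ⟨j, -⟩ := (P.cover _).1 hk'
      exact (Nat.zero_lt_of_lt j.2).trans_le kappa_le_beta
  exact_mod_cast this

theorem totalLoss_nonneg (hℓ : ∀ t < T, ∀ i, ℓ t i ∈ Set.Icc (0 : ℝ) 1) (i : Fin K) :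
    0 ≤ totalLoss T ℓ i :=
  Finset.sum_nonneg fun t ht => (hℓ t (Finset.mem_range.1 ht) i).1

theorem weighted_sum_le {Λ x y z : ℝ} (hΛ : 2 ≤ Λ) (hx : 0 ≤ x) (hy : 0 ≤ y) (hz : 0 ≤ z) :
    3 * x + 64 * z + x + 6 * Λ ^ 2 * z + 200 * (Λ ^ 3 * y) + 48 * y + 3 * z
      ≤ 300 * Λ ^ 3 * (x + y + z) := by
  have h2 := pow_le_pow_left₀ zero_le_two hΛ 2
  have h3 := pow_le_pow_left₀ zero_le_two hΛ 3
  have h23 : 2 * Λ ^ 2 ≤ Λ ^ 3 := by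
    rw [pow_succ' Λ 2]
    exact mul_le_mul_of_nonneg_right hΛ (sq_nonneg Λ)
  linarith [mul_le_mul_of_nonneg_right h3 hx, mul_le_mul_of_nonneg_right h3 hy,
    mul_le_mul_of_nonneg_right h3 hz, mul_le_mul_of_nonneg_right h23 hz]

/-- The regret bound for an arbitrary admissible learning rate. -/
theorem regret_le (hK : 2 ≤ K) (hKT : 2 * K ≤ T) (hG : StronglyObservable G)
    (P : CliquePartition G κ) (hℓ : ∀ t < T, ∀ i, ℓ t i ∈ Set.Icc (0 : ℝ) 1) (istar : Fin K)
    (hη : 0 < η) (hη' : η ≤ etaMax K T (beta G κ)) :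
    regret P T η (64 * (beta G κ : ℝ)) ℓ istar ≤ 600 * Real.log ((K : ℝ) * T) ^ 3 *
      (((κ : ℝ) * Real.log T + Real.log K) / η + η * totalLoss T ℓ istar
        + (beta G κ : ℝ) ^ 2 * Real.log T) := by
  have hT : 4 ≤ T := by omega
  have hT0 : 0 < T := by omega
  have hl := one_le_log hT
  have hL := two_le_log_mul hK hT
  have hb := one_le_beta hK P
  have hβ := beta_le P
  have hLs := totalLoss_nonneg (T := T) hℓ istar
  have hlK : 1 / 2 ≤ Real.log K := by
    have := Real.log_le_log two_pos (by exact_mod_cast hK : (2 : ℝ) ≤ K)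
    linarith [Real.log_two_gt_d9]
  have hKL : Real.log K ≤ Real.log ((K : ℝ) * T) := by
    have hK0 : (0 : ℝ) < K := by exact_mod_cast (by omega : 0 < K)
    have hT0' : (0 : ℝ) < T := by exact_mod_cast hT0
    rw [Real.log_mul hK0.ne' hT0'.ne']
    linarith
  have hTL : Real.log T ≤ Real.log ((K : ℝ) * T) := by
    have hK0 : (0 : ℝ) < K := by exact_mod_cast (by omega : 0 < K)
    have hT0' : (0 : ℝ) < T := by exact_mod_cast hT0
    rw [Real.log_mul hK0.ne' hT0'.ne']
    linarith
  have hcη : 64 * (beta G κ : ℝ) * η ≤ 1 := by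
    have := hη'.trans (min_le_left _ _)
    rw [le_div_iff₀ (by linarith)] at this
    linarith
  have hηL : η * Real.log T * Real.log ((K : ℝ) * T) ^ 2 ≤ 1 / 1000 := by
    have := hη'.trans (min_le_right _ _)
    rw [le_div_iff₀ (by positivity)] at this
    linarith
  have hη1 : η ≤ 1 / 1000 := by
    have h1 : 1 ≤ Real.log T * Real.log ((K : ℝ) * T) ^ 2 := by nlinarith
    nlinarith
  have hkb : (κ : ℝ) + (noLoop G).card = beta G κ := by simp [beta]
  have hκ0 : (0 : ℝ) ≤ κ := Nat.cast_nonneg κ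
  obtain ⟨m, -⟩ : ∃ m : MetaNode G κ, True := by
    have : 0 < Fintype.card (MetaNode G κ) := by
      rw [card_metaNode]
      exact_mod_cast lt_of_lt_of_le one_pos hb
    exact ⟨(Fintype.card_pos_iff.1 this).some, trivial⟩
  have hp : Params G κ T η (64 * (beta G κ : ℝ)) :=
    ⟨hT, by omega, hη, hη1, by linarith, _, metaComparator_mem hT0 (by omega) m⟩
  set Λ := Real.log ((K : ℝ) * T) with hΛ
  set b := (beta G κ : ℝ) with hbdef
  set Ls := totalLoss T ℓ istar
  set Q1 := ((κ : ℝ) * Real.log T + Real.log K) / η with hQ1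
  set Q2 := η * Ls with hQ2
  set Q3 := b ^ 2 * Real.log T with hQ3
  have hQ1' : 0 ≤ Q1 := div_nonneg (by nlinarith) hη.le
  have hQ2' : 0 ≤ Q2 := by positivity
  have hQ3' : b ^ 2 ≤ Q3 := by rw [hQ3]; nlinarith [sq_nonneg b]
  have hb2 : b ≤ b ^ 2 := by nlinarith
  have hη0 : 0 < 1 / η := by positivity
  have hone : 1 / η ≤ 2 * Q1 := by
    rw [hQ1, ← mul_div_assoc]
    gcongr
    nlinarith
  have hκη : κ / η ≤ Q1 := by
    rw [hQ1]
    gcongr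
    nlinarith
  have hfirst : ((κ : ℝ) * Real.log T + Real.log K + 1) / η + 64 * b * (noLoop G).card * Real.log T
      ≤ 3 * Q1 + 64 * Q3 := by
    rw [add_div]
    have h1 : b * (noLoop G).card * Real.log T ≤ Q3 := by
      rw [hQ3, sq]
      gcongr
      linarith
    linarith
  have hB : 2 * Λ * (1 + b * (3 * b + Real.log K)) ≤ 6 * Λ ^ 2 * Q3 := by
    have h1 : 1 + b * (3 * b + Real.log K) ≤ 3 * Λ * b ^ 2 := by
      have h2 : b * Real.log K ≤ b ^ 2 * Λ := mul_le_mul hb2 hKL (by linarith) (by positivity)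
      nlinarith
    calc 2 * Λ * (1 + b * (3 * b + Real.log K)) ≤ 2 * Λ * (3 * Λ * b ^ 2) := by gcongr
      _ = 6 * Λ ^ 2 * b ^ 2 := by ring
      _ ≤ 6 * Λ ^ 2 * Q3 := by gcongr
  have hx : η * Real.log T * Λ ^ 2 * Ls ≤ Λ ^ 3 * Q2 := by
    calc η * Real.log T * Λ ^ 2 * Ls = Real.log T * (Λ ^ 2 * (η * Ls)) := by ring
      _ ≤ Λ * (Λ ^ 2 * (η * Ls)) := by gcongr
      _ = Λ ^ 3 * Q2 := by rw [hQ2]; ring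
  have hmain : (1 - 48 * η) * regret P T η (64 * b) ℓ istar ≤
      3 * Q1 + 64 * Q3 + Q1 + 6 * Λ ^ 2 * Q3 + 200 * (Λ ^ 3 * Q2) + 48 * Q2 + 3 * Q3 := by
    by_cases hi : istar ∈ noLoop G
    · have h := regret_le_of_mem_noLoop (P := P) hp hK hKT hG hℓ hi
      have h1 : 0 ≤ 6 * Λ ^ 2 * Q3 := by positivity
      have h2 : 0 ≤ Λ ^ 3 * Q2 := by positivity
      have e : (0 + 48 * η) * Ls = 48 * Q2 := by rw [hQ2]; ring
      rw [e] at h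
      linarith
    · have hk' : G.Adj istar istar := by simpa [noLoop] using hi
      obtain ⟨k, hk⟩ := (P.cover istar).1 hk'
      have h := regret_le_of_mem_cell (P := P) hp hK hKT hG hL hηL hcη hℓ hk
      have e : (200 * (η * Real.log T * Λ ^ 2) + 48 * η) * Ls
          = 200 * (η * Real.log T * Λ ^ 2 * Ls) + 48 * Q2 := by rw [hQ2]; ring
      rw [e] at h
      linarith
  have hQ30 : 0 ≤ Q3 := (sq_nonneg b).trans hQ3'
  have hreg := hmain.trans (weighted_sum_le hL hQ1' hQ2' hQ30)
  have hnn : 0 ≤ 300 * Λ ^ 3 * (Q1 + Q2 + Q3) := by positivity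
  -- Dividing by `1 - 48 * η ≥ 1/2` doubles the constant, but only for positive regret; otherwise
  -- the right-hand side is already nonnegative.
  rcases le_or_gt (regret P T η (64 * b) ℓ istar) 0 with h | h
  · linarith
  · have := mul_le_mul_of_nonneg_right (by linarith : 1 / 2 ≤ 1 - 48 * η) h.le
    linarith

theorem etaMax_pos (hT : 4 ≤ T) (hK : 2 ≤ K) {β : ℕ} (hβ : (1 : ℝ) ≤ β) : 0 < etaMax K T β := by
  have hl := one_le_log hT
  have hL := two_le_log_mul hK hT
  exact lt_min (by positivity) (by positivity)

theorem one_div_etaMax_le (hT : 4 ≤ T) (hK : 2 ≤ K) {β : ℕ} (hβ : (1 : ℝ) ≤ β) :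
    1 / etaMax K T β ≤ 64 * β + 1000 * Real.log ((K : ℝ) * T) ^ 3 := by
  have hl := one_le_log hT
  have hL := two_le_log_mul hK hT
  have hTL : Real.log T ≤ Real.log ((K : ℝ) * T) := by
    have hT0 : (0 : ℝ) < T := by exact_mod_cast (by omega : 0 < T)
    have hK1 : (1 : ℝ) ≤ K := by exact_mod_cast (by omega : 1 ≤ K)
    exact Real.log_le_log hT0 (by nlinarith)
  have h3 : 1000 * Real.log T * Real.log ((K : ℝ) * T) ^ 2
      ≤ 1000 * Real.log ((K : ℝ) * T) ^ 3 := by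
    calc _ = 1000 * (Real.log T * Real.log ((K : ℝ) * T) ^ 2) := by ring
      _ ≤ 1000 * (Real.log ((K : ℝ) * T) * Real.log ((K : ℝ) * T) ^ 2) := by gcongr
      _ = _ := by ring
  have h4 : (0 : ℝ) ≤ 64 * β := by linarith
  have h5 : 0 ≤ 1000 * Real.log ((K : ℝ) * T) ^ 3 := by positivity
  rcases min_choice (1 / (64 * (β : ℝ)))
    (1 / (1000 * Real.log T * Real.log ((K : ℝ) * T) ^ 2)) with h | h
  · rw [etaMax, h, one_div_one_div]; linarith
  · rw [etaMax, h, one_div_one_div]; linarith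

/-- The trade-off that the tuned learning rate achieves. -/
theorem etaTuned_tradeoff (hT : 4 ≤ T) (hK : 2 ≤ K) {β : ℕ} (hβ : (1 : ℝ) ≤ β) (κ : ℕ)
    {Ls : ℝ} (hLs : 0 ≤ Ls) :
    (0 < etaTuned K T β κ Ls ∧ etaTuned K T β κ Ls ≤ etaMax K T β) ∧
    (κ + 1) / etaTuned K T β κ Ls + etaTuned K T β κ Ls * Ls
      ≤ 2 * √((κ + 1) * Ls) + (κ + 1) * (64 * β + 1000 * Real.log ((K : ℝ) * T) ^ 3) := by
  have hmax := etaMax_pos hT hK hβ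
  have hinv := one_div_etaMax_le hT hK hβ
  have hκ : (0 : ℝ) < κ + 1 := by positivity
  have hdiv : (κ + 1) / etaMax K T β
      ≤ (κ + 1) * (64 * β + 1000 * Real.log ((K : ℝ) * T) ^ 3) := by
    rw [div_eq_mul_one_div]
    exact mul_le_mul_of_nonneg_left hinv hκ.le
  rcases hLs.eq_or_lt with h0 | hpos
  · rw [etaTuned, if_pos h0.symm, ← h0]
    refine ⟨⟨hmax, le_rfl⟩, ?_⟩
    simpa using hdiv
  · rw [etaTuned, if_neg hpos.ne']
    have hsq : 0 < √(((κ : ℝ) + 1) / Ls) := Real.sqrt_pos.2 (by positivity)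
    refine ⟨⟨lt_min hmax hsq, min_le_left _ _⟩, ?_⟩
    have e1 : √(((κ : ℝ) + 1) / Ls) * Ls = √((κ + 1) * Ls) := by
      rw [Real.sqrt_div hκ.le, Real.sqrt_mul hκ.le, div_mul_eq_mul_div, mul_div_assoc,
        Real.div_sqrt]
    have e2 : ((κ : ℝ) + 1) / √((κ + 1) / Ls) = √((κ + 1) * Ls) := by
      rw [Real.sqrt_div hκ.le, Real.sqrt_mul hκ.le, div_div_eq_mul_div, mul_div_right_comm,
        Real.div_sqrt]
    have h1 : min (etaMax K T β) √(((κ : ℝ) + 1) / Ls) * Ls ≤ √((κ + 1) * Ls) := by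
      rw [← e1]
      exact mul_le_mul_of_nonneg_right (min_le_right _ _) hpos.le
    have h2 : 0 ≤ √(((κ : ℝ) + 1) * Ls) := Real.sqrt_nonneg _
    have h3 : 0 ≤ ((κ : ℝ) + 1) / etaMax K T β := by positivity
    -- If the cap is active, `(κ + 1) / η` is the lower-order term `hdiv`; otherwise both terms
    -- equal the square root.
    rcases min_choice (etaMax K T β) √(((κ : ℝ) + 1) / Ls) with h | h
    · rw [h] at h1 ⊢
      linarith
    · rw [h] at h1 ⊢
      rw [e2]
      linarith

end Final

end GraphBandit

theorem mainTheorem1 :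
    ∃ A : ℝ, 0 < A ∧ ∃ m : ℕ,
      ∀ (K T : ℕ), 2 ≤ K → 2 * K ≤ T →
      ∀ (G : Digraph (Fin K)), GraphBandit.StronglyObservable G →
      ∀ (κ : ℕ) (P : GraphBandit.CliquePartition G κ)
        (ℓ : ℕ → Fin K → ℝ), (∀ t < T, ∀ i, ℓ t i ∈ Set.Icc (0 : ℝ) 1) →
      ∀ (istar : Fin K),
        (∀ i, GraphBandit.totalLoss T ℓ istar ≤ GraphBandit.totalLoss T ℓ i) →
      (∀ η : ℝ, 0 < η → η ≤ GraphBandit.etaMax K T (GraphBandit.beta G κ) →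
        GraphBandit.regret P T η (64 * (GraphBandit.beta G κ : ℝ)) ℓ istar ≤
          A * Real.log ((K : ℝ) * T) ^ m *
            (((κ : ℝ) * Real.log T + Real.log K) / η
              + η * GraphBandit.totalLoss T ℓ istar
              + (GraphBandit.beta G κ : ℝ) ^ 2 * Real.log T)) ∧
      (∀ η : ℝ,
        η = GraphBandit.etaTuned K T (GraphBandit.beta G κ) κ (GraphBandit.totalLoss T ℓ istar) →
        GraphBandit.regret P T η (64 * (GraphBandit.beta G κ : ℝ)) ℓ istar ≤
          A * Real.log ((K : ℝ) * T) ^ m *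
            (√(((κ : ℝ) + 1) * GraphBandit.totalLoss T ℓ istar)
              + (GraphBandit.beta G κ : ℝ) ^ 2)) := by
  -- `600 * 3000`, and exponent `3 + 1 + 3`: from part (a), from extracting `log T` and `log K`, and
  -- from `1 / etaMax`.
  refine ⟨1800000, by norm_num, 7, ?_⟩
  intro K T hK hKT G hG κ P ℓ hℓ istar _
  have hT : 4 ≤ T := by omega
  have hl := GraphBandit.one_le_log hT
  have hL := GraphBandit.two_le_log_mul hK hT
  have hb := GraphBandit.one_le_beta hK P
  have hLs := GraphBandit.totalLoss_nonneg (T := T) hℓ istar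
  have hK1 : (1 : ℝ) ≤ K := by exact_mod_cast (by omega : 1 ≤ K)
  have hT1 : (1 : ℝ) ≤ T := by exact_mod_cast (by omega : 1 ≤ T)
  have hlK : 0 ≤ Real.log K := Real.log_natCast_nonneg K
  have hTL : Real.log T ≤ Real.log ((K : ℝ) * T) :=
    Real.log_le_log (by linarith) (by nlinarith)
  have hKL : Real.log K ≤ Real.log ((K : ℝ) * T) :=
    Real.log_le_log (by linarith) (by nlinarith)
  have hκb : (κ : ℝ) ≤ GraphBandit.beta G κ := by
    exact_mod_cast GraphBandit.kappa_le_beta (G := G)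
  have hκ0 : (0 : ℝ) ≤ κ := Nat.cast_nonneg κ
  have ha := fun (η : ℝ) (hη : 0 < η)
      (hη' : η ≤ GraphBandit.etaMax K T (GraphBandit.beta G κ)) =>
    GraphBandit.regret_le hK hKT hG P hℓ istar hη hη'
  set Λ := Real.log ((K : ℝ) * T) with hΛ
  set b := (GraphBandit.beta G κ : ℝ) with hbdef
  set Ls := GraphBandit.totalLoss T ℓ istar
  refine ⟨fun η hη hη' => (ha η hη hη').trans ?_, fun η hη => ?_⟩
  · have : 0 ≤ ((κ : ℝ) * Real.log T + Real.log K) / η + η * Ls + b ^ 2 * Real.log T := by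
      positivity
    refine mul_le_mul_of_nonneg_right ?_ this
    have h37 : Λ ^ 3 ≤ Λ ^ 7 := pow_le_pow_right₀ (by linarith) (by norm_num)
    have : 0 ≤ Λ ^ 3 := by positivity
    linarith
  · obtain ⟨⟨hη0, hηm⟩, htrade⟩ :=
      GraphBandit.etaTuned_tradeoff hT hK hb κ hLs
    rw [← hη] at hη0 hηm htrade
    refine (ha η hη0 hηm).trans ?_
    have hΛ3 : 1 ≤ Λ ^ 3 := one_le_pow₀ (by linarith)
    have h1 : ((κ : ℝ) * Real.log T + Real.log K) / η + η * Ls + b ^ 2 * Real.log T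
        ≤ Λ * ((κ + 1) / η + η * Ls + b ^ 2) := by
      have e1 : ((κ : ℝ) * Real.log T + Real.log K) / η ≤ Λ * ((κ + 1) / η) := by
        rw [← mul_div_assoc]
        gcongr
        nlinarith
      have e2 : η * Ls ≤ Λ * (η * Ls) := le_mul_of_one_le_left (by positivity) (by linarith)
      have e3 : b ^ 2 * Real.log T ≤ Λ * b ^ 2 := by
        rw [mul_comm]
        gcongr
      linarith
    have h2 : (κ + 1) / η + η * Ls + b ^ 2 ≤ 3000 * Λ ^ 3 * (√((κ + 1) * Ls) + b ^ 2) := by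
      -- The cost of the capped rate is quadratic in `b`, by `κ + 1 ≤ 2 * b` and `1 ≤ b`.
      have e1 : ((κ : ℝ) + 1) * (64 * b + 1000 * Λ ^ 3) ≤ 2 * b * (1064 * Λ ^ 3 * b) := by
        refine mul_le_mul (by linarith) ?_ (by positivity) (by positivity)
        nlinarith [mul_le_mul_of_nonneg_right hΛ3 (by linarith : 0 ≤ b),
          mul_le_mul_of_nonneg_left hb (by positivity : 0 ≤ Λ ^ 3)]
      have e2 := Real.sqrt_nonneg (((κ : ℝ) + 1) * Ls)
      have e3 := mul_le_mul_of_nonneg_right hΛ3 e2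
      have e4 := mul_le_mul_of_nonneg_right hΛ3 (sq_nonneg b)
      nlinarith
    calc 600 * Λ ^ 3 * (((κ : ℝ) * Real.log T + Real.log K) / η + η * Ls + b ^ 2 * Real.log T)
        ≤ 600 * Λ ^ 3 * (Λ * (3000 * Λ ^ 3 * (√((κ + 1) * Ls) + b ^ 2))) := by
          refine mul_le_mul_of_nonneg_left (h1.trans ?_) (by positivity)
          exact mul_le_mul_of_nonneg_left h2 (by linarith)
      _ = 1800000 * Λ ^ 7 * (√((κ + 1) * Ls) + b ^ 2) := by ring
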